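/- **Theorem 3.1 (Poincaré–Friedrichs inequality).** Let $d\in\{2,3\}$, let $\Omega\subset\mathbb{R}^d$ be a nonempty bounded convex polytopal open set, and let $\mathcal{T}$ be a finite conforming partition of $\Omega$ into closed simplices, with shape-regularity parameter $\vartheta_{\mathcal T}=\max_{K\in\mathcal T}\operatorname{diam}K/\rho_K$, where $\rho_K$ is the diameter of the largest ball contained in $K$. Let $\mathcal F$ and $\mathcal F^I\subset\mathcal F$ be the sets of all and of interior $(d-1)$-dimensional faces of $\mathcal T$, and let $h_F=\mathcal H^{d-1}(F)^{1/(d-1)}$ for $F\in\mathcal F$, where $\mathcal H^{d-1}$ is the $(d-1)$-dimensional Hausdorff measure. For $p\ge 2$ let $$V^0_{\mathcal T}=\{v\in L^2(\Omega): v|_K \text{ is a polynomial of total degree at most } p \text{ for all } K\in\mathcal T\},\qquad V^1_{\mathcal T}=V^0_{\mathcal T}\cap H^1_0(\Omega)$$ be the discontinuous Galerkin (DG) and $C^0$ interior penalty ($C^0$-IP) spaces. For $v\in V^0_{\mathcal T}$ let $\nabla v$ and $\nabla^2v$ denote the piecewise gradient and Hessian, let $[\![\cdot]\!]_F$ denote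 the jump across $F$ (the difference of the traces from the two elements sharing $F$ if $F\in\mathcal F^I$, and the trace itself if $F$ is a boundary face), and set $$|v|_J^2=\sum_{F\in\mathcal F^I}\int_F h_F^{-1}\bigl|[\![\nabla v]\!]_F\bigr|^2\,d\mathcal H^{d-1}+\sum_{F\in\mathcal F}\int_F h_F^{-3}\bigl|[\![v]\!]_F\bigr|^2\,d\mathcal H^{d-1},$$ $$\|v\|_{\mathcal T}^2=\int_\Omega\bigl(|\nabla^2v|^2+|\nabla v|^2+|v|^2\bigr)+|v|_J^2,$$ where $|\nabla^2 v|$ is the Frobenius norm. Then there exists a constant $C_{\mathrm{PF}}$ depending only on $d$, $\vartheta_{\mathcal T}$, $p$ and $\operatorname{diam}\Omega$ such that $$\|v\|_{\mathcal T}\le C_{\mathrm{PF}}\left(\int_\Omega|\nabla^2v|^2+|v|_J^2\right)^{1/2}\qquad\text{for all } v\in V^s_{\mathcal T},\ s\in\{0,1\}.$$ -/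

import Mathlib

open MeasureTheory Filter Topology
open scoped ContDiff ENNReal

namespace DGFEM

/-- Euclidean space `ℝ^d`. -/
abbrev E (d : ℕ) : Type := EuclideanSpace ℝ (Fin d)

/-- A bounded convex polytopal (nonempty) open set in `ℝ^d`. -/
structure IsConvexPolytopalDomain {d : ℕ} (Ω : Set (E d)) : Prop where
  isOpen : IsOpen Ω
  nonempty : Ω.Nonempty
  isBounded : Bornology.IsBounded Ω
  convex : Convex ℝ Ω
  polytopal : ∃ S : Finset (E d), closure Ω = convexHull ℝ (S : Set (E d))

/-- A finite conforming partition of `Ω` into closed simplices, given as a finite geometric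
simplicial complex (simplices are recorded through their vertex sets, and any two of them meet in
the convex hull of their common vertices, i.e. there are no hanging nodes) whose underlying space
is the closure of `Ω`. -/
structure Mesh {d : ℕ} (Ω : Set (E d)) extends Geometry.SimplicialComplex ℝ (E d) where
  finite_faces : faces.Finite
  space_eq : toSimplicialComplex.space = closure Ω

/-- The closed simplex with vertex set `s`. -/
abbrev hull {d : ℕ} (s : Finset (E d)) : Set (E d) := convexHull ℝ (s : Set (E d))

/-- The diameter `ρ_K` of the largest ball contained in the set `K`. -/
noncomputable def inballDiam {d : ℕ} (K : Set (E d)) : ℝ :=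
  sSup {δ : ℝ | ∃ (x : E d) (r : ℝ), 0 ≤ r ∧ Metric.closedBall x r ⊆ K ∧ δ = 2 * r}

/-- Membership in `H^1_0(Ω)`, the closure of `C_c^∞(Ω)` in the `H^1`-norm: `v ∈ L²(Ω)` and there
are `G ∈ L²(Ω; ℝ^d)` (which is then the weak gradient of `v`) and functions `φ n ∈ C_c^∞(Ω)` with
`φ n → v` and `∇ φ n → G` in `L²(Ω)`. -/
def MemH10 {d : ℕ} (Ω : Set (E d)) (v : E d → ℝ) : Prop :=
  MemLp v 2 (volume.restrict Ω) ∧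
  ∃ G : E d → E d, MemLp G 2 (volume.restrict Ω) ∧
    ∃ φ : ℕ → E d → ℝ,
      (∀ n, ContDiff ℝ ∞ (φ n) ∧ HasCompactSupport (φ n) ∧ tsupport (φ n) ⊆ Ω) ∧
      Tendsto (fun n => eLpNorm (fun x => v x - φ n x) 2 (volume.restrict Ω)) atTop (𝓝 0) ∧
      Tendsto (fun n => eLpNorm (fun x => G x - gradient (φ n) x) 2 (volume.restrict Ω))
        atTop (𝓝 0)

/-- The value at `x ∈ ℝ^d` of a polynomial in `d` variables. -/
noncomputable def polyVal {d : ℕ} (P : MvPolynomial (Fin d) ℝ) (x : E d) : ℝ :=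
  MvPolynomial.eval (fun i => x i) P

open Classical in
/-- The polynomial that agrees almost everywhere with `v` on `K`, for functions `v` that are
polynomial on `K` (it is unique if `K` is a nondegenerate simplex, see `localPoly_eq`);
the value is `0` if there is none. -/
noncomputable def localPoly {d : ℕ} (v : E d → ℝ) (K : Set (E d)) : MvPolynomial (Fin d) ℝ :=
  if h : ∃ P : MvPolynomial (Fin d) ℝ, v =ᵐ[volume.restrict K] polyVal P then h.choose else 0

theorem polyVal_continuous {d : ℕ} (P : MvPolynomial (Fin d) ℝ) : Continuous (polyVal P) := by
  unfold polyVal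
  exact (MvPolynomial.continuous_eval P).comp (by fun_prop)

theorem poly_unique {d : ℕ} {P Q : MvPolynomial (Fin d) ℝ} {K : Set (E d)}
    (hK : (interior K).Nonempty) (h : polyVal P =ᵐ[volume.restrict K] polyVal Q) : P = Q := by
  have h1 : polyVal P =ᵐ[volume.restrict (interior K)] polyVal Q :=
    ae_restrict_of_ae_restrict_of_subset interior_subset h
  have h2 : Set.EqOn (polyVal P) (polyVal Q) (interior K) :=
    Measure.eqOn_open_of_ae_eq h1 isOpen_interior
      (polyVal_continuous P).continuousOn (polyVal_continuous Q).continuousOn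
  obtain ⟨x, hx⟩ := hK
  have ho : IsOpen ((fun y : Fin d → ℝ => (WithLp.toLp 2 y : E d)) ⁻¹' interior K) :=
    isOpen_interior.preimage (by fun_prop)
  obtain ⟨ε, hε, hb⟩ := Metric.isOpen_iff.1 ho (fun i => x i) hx
  refine MvPolynomial.funext_set (fun i => Metric.ball (x i) ε) (fun i => ?_) (fun y hy => ?_)
  · rw [Real.ball_eq_Ioo]
    exact Set.Ioo_infinite (by linarith)
  · have hy' : y ∈ Metric.ball (fun i => x i) ε := by
      rw [ball_pi _ hε]
      exact hy
    exact h2 (hb hy')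

/-- `localPoly` is well defined on sets with nonempty interior. -/
theorem localPoly_eq {d : ℕ} {v : E d → ℝ} {K : Set (E d)} {P : MvPolynomial (Fin d) ℝ}
    (hK : (interior K).Nonempty) (h : v =ᵐ[volume.restrict K] polyVal P) :
    localPoly v K = P := by
  have hex : ∃ P : MvPolynomial (Fin d) ℝ, v =ᵐ[volume.restrict K] polyVal P := ⟨P, h⟩
  rw [localPoly, dif_pos hex]
  exact poly_unique hK (hex.choose_spec.symm.trans h)

namespace Mesh

variable {d : ℕ} {Ω : Set (E d)}

open Classical in
/-- The elements of the mesh: the (vertex sets of the) `d`-dimensional simplices. -/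
noncomputable def cells (T : Mesh Ω) : Finset (Finset (E d)) :=
  T.finite_faces.toFinset.filter (fun s => s.card = d + 1)

open Classical in
/-- The (vertex sets of the) `(d-1)`-dimensional faces of the mesh. -/
noncomputable def facets (T : Mesh Ω) : Finset (Finset (E d)) :=
  T.finite_faces.toFinset.filter (fun s => s.card = d)

open Classical in
/-- The elements that contain the face `F`. -/
noncomputable def adjacentCells (T : Mesh Ω) (F : Finset (E d)) : Finset (Finset (E d)) :=
  T.cells.filter (fun K => F ⊆ K)

open Classical in
/-- The interior faces: those shared by two distinct elements. -/
noncomputable def interiorFacets (T : Mesh Ω) : Finset (Finset (E d)) :=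
  T.facets.filter (fun F => ∃ K ∈ T.cells, ∃ K' ∈ T.cells, K ≠ K' ∧ F ⊆ K ∧ F ⊆ K')

/-- The shape-regularity parameter `max_K diam K / ρ_K`. -/
noncomputable def shapeRegularity (T : Mesh Ω) : ℝ :=
  ⨆ K : T.cells, Metric.diam (hull K.1) / inballDiam (hull K.1)

/-- The space `V^0` of (classes of) functions in `L²(Ω)` whose restriction to each element is a
polynomial of total degree at most `p`. -/
def dgSpace (T : Mesh Ω) (p : ℕ) : Set (E d → ℝ) :=
  {v | MemLp v 2 (volume.restrict Ω) ∧
    ∀ K ∈ T.cells, ∃ P : MvPolynomial (Fin d) ℝ,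
      P.totalDegree ≤ p ∧ v =ᵐ[volume.restrict (hull K)] polyVal P}

/-- The finite element spaces: `V^0` (discontinuous Galerkin) for `s = 0`, and
`V^1 = V^0 ∩ H^1_0(Ω)` (`C^0` interior penalty) for `s = 1`. -/
def feSpace (T : Mesh Ω) (p : ℕ) (s : Fin 2) : Set (E d → ℝ) :=
  if s = 0 then T.dgSpace p else T.dgSpace p ∩ {v | MemH10 Ω v}

/-- The function that equals `w K` in the interior of each element `K` (and `0` elsewhere). -/
noncomputable def piecewise {V : Type*} [AddCommMonoid V] (T : Mesh Ω)
    (w : Finset (E d) → E d → V) (x : E d) : V :=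
  ∑ K ∈ T.cells, (interior (hull K)).indicator (w K) x

/-- The gradient on the element `K` of a piecewise polynomial `v`. -/
noncomputable def localGrad (v : E d → ℝ) (K : Finset (E d)) (x : E d) : E d :=
  WithLp.toLp 2 fun i => polyVal (MvPolynomial.pderiv i (localPoly v (hull K))) x

/-- The Hessian on the element `K` of a piecewise polynomial `v`. -/
noncomputable def localHess (v : E d → ℝ) (K : Finset (E d)) (x : E d) :
    Matrix (Fin d) (Fin d) ℝ :=
  Matrix.of fun i j =>
    polyVal (MvPolynomial.pderiv j (MvPolynomial.pderiv i (localPoly v (hull K)))) x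

/-- The piecewise gradient `∇ v`, defined almost everywhere in `Ω`. -/
noncomputable def grad (T : Mesh Ω) (v : E d → ℝ) : E d → E d :=
  T.piecewise (localGrad v)

/-- The piecewise Hessian `∇² v`, defined almost everywhere in `Ω`. -/
noncomputable def hess (T : Mesh Ω) (v : E d → ℝ) : E d → Matrix (Fin d) (Fin d) ℝ :=
  T.piecewise (localHess v)

open Classical in
/-- The jump across the face `F` of a family of traces `w K`: on a face shared by two elements
`K ≠ K'` it is `w K - w K'` (the labelling is a choice of the unit normal of `F`; it only
affects the sign), and on a boundary face it is `w K` for the only element `K` containing `F`. -/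
noncomputable def jump {V : Type*} [AddCommGroup V] (T : Mesh Ω)
    (w : Finset (E d) → V) (F : Finset (E d)) : V :=
  if h : ∃ K K', K ∈ T.cells ∧ K' ∈ T.cells ∧ K ≠ K' ∧ F ⊆ K ∧ F ⊆ K' then
    w h.choose - w h.choose_spec.choose
  else ∑ K ∈ T.adjacentCells F, w K

/-- The jump of `v` on `F`. The trace on `F` of the restriction of `v` to `K` is the value of the
polynomial that represents `v` on `K`. -/
noncomputable def jumpVal (T : Mesh Ω) (v : E d → ℝ) (F : Finset (E d)) (x : E d) : ℝ :=
  T.jump (fun K => polyVal (localPoly v (hull K)) x) F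

/-- The jump of `∇ v` on `F`. -/
noncomputable def jumpGrad (T : Mesh Ω) (v : E d → ℝ) (F : Finset (E d)) (x : E d) : E d :=
  T.jump (fun K => localGrad v K x) F

end Mesh

/-- `h_F`, the `(d-1)`-th root of the `(d-1)`-dimensional Hausdorff measure of the face `F`
(`μHE[k]` is the `k`-dimensional Hausdorff measure, normalized so that it is the Lebesgue measure
on `k`-dimensional subspaces). -/
noncomputable def faceSize {d : ℕ} (F : Finset (E d)) : ℝ :=
  ((μHE[d - 1] : Measure (E d)).real (hull F)) ^ (1 / ((d : ℝ) - 1))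

namespace Mesh

variable {d : ℕ} {Ω : Set (E d)}

/-- The square `|v|_J²` of the jump seminorm. -/
noncomputable def jumpSeminormSq (T : Mesh Ω) (v : E d → ℝ) : ℝ :=
  (∑ F ∈ T.interiorFacets,
      (∫ x in hull F, (faceSize F)⁻¹ * ‖T.jumpGrad v F x‖ ^ 2 ∂(μHE[d - 1] : Measure (E d))))
    + (∑ F ∈ T.facets,
      (∫ x in hull F, ((faceSize F) ^ 3)⁻¹ * |T.jumpVal v F x| ^ 2 ∂(μHE[d - 1] : Measure (E d))))

/-- The squared Frobenius norm of the piecewise Hessian. -/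
noncomputable def hessSq (T : Mesh Ω) (v : E d → ℝ) (x : E d) : ℝ :=
  ∑ i, ∑ j, (T.hess v x i j) ^ 2

/-- The norm `‖v‖_T` of the finite element spaces. -/
noncomputable def meshNorm (T : Mesh Ω) (v : E d → ℝ) : ℝ :=
  Real.sqrt ((∫ x in Ω, (T.hessSq v x + ‖T.grad v x‖ ^ 2 + |v x| ^ 2)) + T.jumpSeminormSq v)

end Mesh

end DGFEM

/-!
The Poincaré–Friedrichs inequality for piecewise polynomials holds already in the larger,
discontinuous space, where a function is given by one polynomial `q K` on each element `K`.
Write `V`, `G`, `H` for the squared `L²` norms of the function, of its piecewise gradient and of its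
piecewise Hessian, and `J` for the squared jump seminorm.

The basic tool is the elementwise divergence theorem in the form
`|∑ K, ∫ x in K, ∂ᵢ(g K)| ≤ ∑ F, ∫ x in F, |⟦g⟧|` (`Mesh.abs_sum_integral_pderiv_le`). On a single
simplex it is the fundamental theorem of calculus along the edges of a reference simplex
(`setIntegral_edge_deriv`, `IsCell.setIntegral_pderiv`). The `i`-th component of the flux
through a face is, up to its sign, a minor of the edge matrix of the face, hence bounded by the area
of the face (`abs_flux_le`), and the sign depends only on the side of the opposite vertex
(`flux_antisymm`); two elements of a conforming mesh with a common face lie on opposite sides of it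
(`opposite_sides`).

For `g = q² (x₀ - z₀)` with a point `z` of the domain, `∂₀g = q² + 2 q ∂₀q (x₀ - z₀)`, and this
bounds `V` by `G` and the jumps of `q²` (`Mesh.cellNormSq_le`). For `g = q ∂ᵢq`, where
`∂ᵢg = (∂ᵢq)² + q ∂ᵢ∂ᵢq`, it bounds `G` by a small multiple of `V` and by `H` and the jumps of
`q ∂ᵢq` (`Mesh.sum_cellNormSq_pderiv_le`). In both cases the jump of a product is a sum of products
of a jump and a trace. By Young's inequality the jumps enter with the weights `h⁻¹` (for the jumps
of `q`, `h⁻¹ ≤ C h⁻³` by `h ≤ C diam Ω`), and the traces with the weight `h` and a small factor;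
the discrete trace inequality
`h ‖q‖²_{L²(F)} ≤ C ‖q‖²_{L²(K)}` (`IsCell.trace_inequality`), which follows from the equivalence of
norms on polynomials of bounded degree and from shape regularity, turns the traces into `V` and `G`,
and these terms are absorbed. On a boundary face only the jump of `q`, not that of `∂ᵢq`, occurs,
because there `|⟦q ∂ᵢq⟧| = |⟦q⟧| |∂ᵢq|`; so the jumps of the gradient across interior faces suffice.
-/

namespace DGFEM

/-! ### Simplices as affine images of a reference simplex -/

/-- The reference simplex `{y | 0 ≤ y, ∑ y ≤ 1}` in `ℝ^n`. -/
def cornerSimplex (n : ℕ) : Set (E n) := {y | (∀ j, 0 ≤ y j) ∧ ∑ j, y j ≤ 1}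

/-- The linear map that sends the `j`-th unit vector to the edge from `e 0` to `e (j + 1)`. -/
noncomputable def edgeMap {n m : ℕ} (e : Fin (n + 1) → E m) : E n →ₗ[ℝ] E m where
  toFun y := ∑ j, y j • (e j.succ - e 0)
  map_add' x y := by simp [add_smul, Finset.sum_add_distrib]
  map_smul' c x := by simp [Finset.smul_sum, smul_smul]

/-- The affine map that sends the vertices of the reference simplex to the points `e j`. -/
noncomputable def simplexParam {n m : ℕ} (e : Fin (n + 1) → E m) (y : E n) : E m :=
  e 0 + edgeMap e y

theorem edgeMap_apply {n m : ℕ} (e : Fin (n + 1) → E m) (y : E n) :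
    edgeMap e y = ∑ j, y j • (e j.succ - e 0) := rfl

theorem continuous_simplexParam {n m : ℕ} (e : Fin (n + 1) → E m) :
    Continuous (simplexParam e) :=
  continuous_const.add (edgeMap e).continuous_of_finiteDimensional

theorem isCompact_cornerSimplex (n : ℕ) : IsCompact (cornerSimplex n) := by
  refine Metric.isCompact_of_isClosed_isBounded ?_ ?_
  · have h : cornerSimplex n = (⋂ j, {y : E n | 0 ≤ y j}) ∩ {y : E n | ∑ j, y j ≤ 1} := by
      ext y; simp [cornerSimplex]
    rw [h]
    refine (isClosed_iInter fun j => isClosed_le continuous_const (by fun_prop)).inter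
      (isClosed_le (by fun_prop) continuous_const)
  · refine (Metric.isBounded_closedBall (x := (0 : E n)) (r := Real.sqrt n)).subset ?_
    intro y hy
    rw [mem_closedBall_zero_iff, EuclideanSpace.norm_eq]
    apply Real.sqrt_le_sqrt
    have h1 : ∀ j, ‖y j‖ ^ 2 ≤ 1 := by
      intro j
      have h2 : y j ≤ 1 :=
        (Finset.single_le_sum (fun i _ => hy.1 i) (Finset.mem_univ j)).trans hy.2
      rw [Real.norm_eq_abs, abs_of_nonneg (hy.1 j)]
      have := hy.1 j
      nlinarith
    calc ∑ j, ‖y j‖ ^ 2 ≤ ∑ _j : Fin n, (1 : ℝ) := Finset.sum_le_sum fun j _ => h1 j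
      _ = n := by simp

theorem measurableSet_cornerSimplex (n : ℕ) : MeasurableSet (cornerSimplex n) :=
  (isCompact_cornerSimplex n).measurableSet

/-- The volume of the reference simplex. -/
noncomputable def cornerVolume (n : ℕ) : ℝ := (volume : Measure (E n)).real (cornerSimplex n)

theorem interior_cornerSimplex_nonempty (n : ℕ) : (interior (cornerSimplex n)).Nonempty := by
  have ho : IsOpen ((⋂ j, {y : E n | 0 < y j}) ∩ {y : E n | ∑ j, y j < 1}) :=
    (isOpen_iInter_of_finite fun j => isOpen_lt continuous_const (by fun_prop)).inter
      (isOpen_lt (by fun_prop) continuous_const)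
  have hsub : ((⋂ j, {y : E n | 0 < y j}) ∩ {y : E n | ∑ j, y j < 1}) ⊆ cornerSimplex n := by
    rintro y ⟨h1, h2⟩
    simp only [Set.mem_iInter, Set.mem_ofPred_eq] at h1 h2
    exact ⟨fun j => (h1 j).le, h2.le⟩
  refine ⟨WithLp.toLp 2 fun _ => 1 / ((n : ℝ) + 1), interior_maximal hsub ho ⟨?_, ?_⟩⟩
  · simp only [Set.mem_iInter, Set.mem_ofPred_eq]
    intro j
    positivity
  · simp only [Set.mem_ofPred_eq, Finset.sum_const, Finset.card_univ, Fintype.card_fin,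
      nsmul_eq_mul]
    rw [mul_one_div, div_lt_one (by positivity)]
    linarith

theorem cornerVolume_pos (n : ℕ) : 0 < cornerVolume n := by
  refine ENNReal.toReal_pos ?_ (isCompact_cornerSimplex n).measure_lt_top.ne
  exact (Measure.measure_pos_of_nonempty_interior _ (interior_cornerSimplex_nonempty n)).ne'

theorem simplexParam_eq {n m : ℕ} (e : Fin (n + 1) → E m) (y : E n) :
    simplexParam e y = (1 - ∑ j, y j) • e 0 + ∑ j, y j • e j.succ := by
  simp only [simplexParam, edgeMap_apply, smul_sub, Finset.sum_sub_distrib, sub_smul, one_smul,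
    Finset.sum_smul]
  abel

theorem image_simplexParam {n m : ℕ} (e : Fin (n + 1) → E m) :
    simplexParam e '' cornerSimplex n = convexHull ℝ (Set.range e) := by
  classical
  rw [convexHull_range_eq_exists_affineCombination]
  apply Set.Subset.antisymm
  · rintro _ ⟨y, hy, rfl⟩
    refine ⟨Finset.univ, Fin.cons (1 - ∑ j, y j) (fun j => y j), ?_, ?_, ?_⟩
    · intro i _
      refine Fin.cases ?_ (fun j => ?_) i
      · simpa using hy.2
      · simpa using hy.1 j
    · simp [Fin.sum_univ_succ]
    · rw [Finset.affineCombination_eq_linear_combination _ _ _ (by simp [Fin.sum_univ_succ]),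
        simplexParam_eq, Fin.sum_univ_succ]
      simp
  · rintro _ ⟨s, w, hw0, hw1, rfl⟩
    rw [Finset.affineCombination_eq_linear_combination _ _ _ hw1]
    set w' : Fin (n + 1) → ℝ := fun i => if i ∈ s then w i else 0 with hw'
    have h0 : ∀ i, 0 ≤ w' i := by
      intro i
      by_cases h : i ∈ s
      · simp [hw', h, hw0 i h]
      · simp [hw', h]
    have h1 : ∑ i, w' i = 1 := by
      rw [← hw1]
      simp [hw', Finset.sum_ite_mem]
    have h2 : ∑ i ∈ s, w i • e i = ∑ i, w' i • e i := by
      simp [hw', ite_smul, Finset.sum_ite_mem]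
    rw [h2]
    rw [Fin.sum_univ_succ] at h1 ⊢
    refine ⟨WithLp.toLp 2 fun j => w' j.succ, ⟨fun j => h0 _, ?_⟩, ?_⟩
    · simp only
      have := h0 0
      linarith
    · rw [simplexParam_eq]
      simp only
      rw [← h1]
      simp

theorem edgeMap_injective {n m : ℕ} {e : Fin (n + 1) → E m} (he : AffineIndependent ℝ e) :
    Function.Injective (edgeMap e) := by
  rw [← LinearMap.ker_eq_bot, LinearMap.ker_eq_bot']
  intro y hy
  have h := (affineIndependent_iff_of_fintype ℝ e).1 he
    (Fin.cons (- ∑ j, y j) (fun j => y j)) (by simp [Fin.sum_univ_succ]) ?_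
  · ext j
    simpa using h j.succ
  · have hw : ∑ i, (Fin.cons (- ∑ j, y j) (fun j => y j) : Fin (n + 1) → ℝ) i = 0 := by
      simp [Fin.sum_univ_succ]
    rw [Finset.weightedVSub_eq_linear_combination _ hw, Fin.sum_univ_succ]
    rw [edgeMap_apply] at hy
    simp only [smul_sub, Finset.sum_sub_distrib] at hy
    simp only [Fin.cons_zero, Fin.cons_succ, neg_smul, Finset.sum_smul]
    rw [← hy]
    abel

theorem normDet_edgeMap_pos {n m : ℕ} {e : Fin (n + 1) → E m} (he : AffineIndependent ℝ e) :
    0 < (edgeMap e).normDet := by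
  refine lt_of_le_of_ne (LinearMap.normDet_nonneg _) fun h => ?_
  exact (LinearMap.normDet_eq_zero_iff_ker_ne_bot.1 h.symm)
    (LinearMap.ker_eq_bot.2 (edgeMap_injective he))

theorem hausdorffMeasure_simplexParam_image {n m : ℕ} (e : Fin (n + 1) → E m) (s : Set (E n)) :
    (μHE[n] : Measure (E m)) (simplexParam e '' s)
      = ENNReal.ofReal (edgeMap e).normDet * volume s := by
  have h : simplexParam e '' s = (fun x => e 0 + x) '' (edgeMap e '' s) := by
    rw [Set.image_image]; rfl
  have h2 := (edgeMap e).euclideanHausdorffMeasure_image_eq_normDet_mul_volume s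
  rw [finrank_euclideanSpace_fin] at h2
  rw [h, Isometry.euclideanHausdorffMeasure_image (isometry_add_left (e 0)), h2]

theorem hausdorffMeasure_convexHull {n m : ℕ} (e : Fin (n + 1) → E m) :
    (μHE[n] : Measure (E m)).real (convexHull ℝ (Set.range e))
      = (edgeMap e).normDet * cornerVolume n := by
  rw [← image_simplexParam, Measure.real, hausdorffMeasure_simplexParam_image,
    ENNReal.toReal_mul, ENNReal.toReal_ofReal (LinearMap.normDet_nonneg _)]
  rfl

theorem hausdorffMeasure_convexHull_lt_top {n m : ℕ} (e : Fin (n + 1) → E m) :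
    (μHE[n] : Measure (E m)) (convexHull ℝ (Set.range e)) < ⊤ := by
  rw [← image_simplexParam, hausdorffMeasure_simplexParam_image]
  exact ENNReal.mul_lt_top ENNReal.ofReal_lt_top (isCompact_cornerSimplex n).measure_lt_top

/-- Change of variables from a simplex of arbitrary codimension to the reference simplex. -/
theorem setIntegral_convexHull {n m : ℕ} {e : Fin (n + 1) → E m} (he : AffineIndependent ℝ e)
    (f : E m → ℝ) :
    ∫ x in convexHull ℝ (Set.range e), f x ∂(μHE[n] : Measure (E m))
      = (edgeMap e).normDet * ∫ y in cornerSimplex n, f (simplexParam e y) := by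
  have hinj : Function.Injective (simplexParam e) := fun x y h =>
    edgeMap_injective he (add_left_cancel h)
  have hemb : MeasurableEmbedding (simplexParam e) :=
    (continuous_simplexParam e).measurableEmbedding hinj
  have hcomap : (μHE[n] : Measure (E m)).comap (simplexParam e)
      = ENNReal.ofReal (edgeMap e).normDet • (volume : Measure (E n)) := by
    ext s hs
    rw [hemb.comap_apply, hausdorffMeasure_simplexParam_image]
    rfl
  have hsub : simplexParam e '' cornerSimplex n ⊆ Set.range (simplexParam e) :=
    Set.image_subset_range _ _
  have hmap := hemb.map_comap (μHE[n] : Measure (E m))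
  rw [← image_simplexParam, ← Set.inter_eq_self_of_subset_left hsub,
    ← Measure.restrict_restrict ((isCompact_cornerSimplex n).image
      (continuous_simplexParam e)).measurableSet, ← hmap, hemb.setIntegral_map,
    Set.preimage_image_eq _ hinj, hcomap, Measure.restrict_smul, integral_smul_measure,
    ENNReal.toReal_ofReal (LinearMap.normDet_nonneg _), smul_eq_mul]

/-- Fubini's theorem on the reference simplex, with the first coordinate as inner variable. -/
theorem setIntegral_cornerSimplex_succ {n : ℕ} {f : E (n + 1) → ℝ} (hf : Continuous f) :
    ∫ y in cornerSimplex (n + 1), f y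
      = ∫ z in cornerSimplex n, ∫ t in (0 : ℝ)..(1 - ∑ j, z j),
          f (WithLp.toLp 2 (Fin.cons t fun j => z j)) := by
  set Φ : ℝ × E n → E (n + 1) := fun p => WithLp.toLp 2 (Fin.cons p.1 fun j => p.2 j) with hΦ
  have hΦm : MeasurePreserving Φ (volume.prod volume) volume := by
    have h1 : MeasurePreserving (Prod.map id (WithLp.ofLp : E n → Fin n → ℝ))
        ((volume : Measure ℝ).prod volume) (volume.prod volume) :=
      (MeasurePreserving.id _).prod (PiLp.volume_preserving_ofLp (Fin n))
    have h2 := (volume_preserving_piFinSuccAbove (fun _ : Fin (n + 1) => ℝ) 0).symm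
    have h3 := PiLp.volume_preserving_toLp (Fin (n + 1))
    have h4 := h3.comp (h2.comp h1)
    have h5 : Φ = WithLp.toLp 2 ∘ (MeasurableEquiv.piFinSuccAbove (fun _ => ℝ) 0).symm ∘
        Prod.map id WithLp.ofLp := by
      funext p
      ext i
      refine Fin.cases ?_ (fun j => ?_) i <;> simp [hΦ]
    rw [h5]
    exact h4
  have hΦc : Continuous Φ := by
    refine (PiLp.continuous_toLp 2 _).comp (continuous_pi fun i => ?_)
    refine Fin.cases ?_ (fun j => ?_) i
    · simpa using continuous_fst
    · simp only [Fin.cons_succ]; fun_prop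
  have hΦi : Function.Injective Φ := by
    rintro ⟨t, z⟩ ⟨t', z'⟩ h
    have h' : ∀ i, (Φ (t, z)) i = (Φ (t', z')) i := fun i => by rw [h]
    have h0 := h' 0
    have hs := fun j : Fin n => h' j.succ
    simp only [hΦ, Fin.cons_zero, Fin.cons_succ] at h0 hs
    exact Prod.ext h0 (by ext j; exact hs j)
  have hemb : MeasurableEmbedding Φ := hΦc.measurableEmbedding hΦi
  have hmeas := measurableSet_cornerSimplex (n + 1)
  have hint : Integrable ((cornerSimplex (n + 1)).indicator f) volume :=
    (integrable_indicator_iff hmeas).2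
      (hf.continuousOn.integrableOn_compact (isCompact_cornerSimplex (n + 1)))
  have hmem : ∀ t z, Φ (t, z) ∈ cornerSimplex (n + 1) ↔
      z ∈ cornerSimplex n ∧ t ∈ Set.Icc 0 (1 - ∑ j, z j) := by
    intro t z
    simp only [hΦ, cornerSimplex, Set.mem_ofPred_eq, Fin.forall_fin_succ, Fin.cons_zero,
      Fin.cons_succ, Fin.sum_univ_succ, Set.mem_Icc]
    constructor
    · rintro ⟨⟨h1, h2⟩, h3⟩
      exact ⟨⟨h2, by linarith⟩, h1, by linarith⟩
    · rintro ⟨⟨h1, h2⟩, h3, h4⟩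
      exact ⟨⟨h3, h1⟩, by linarith⟩
  rw [← integral_indicator hmeas, ← hΦm.integral_comp hemb,
    integral_prod_symm (fun p => (cornerSimplex (n + 1)).indicator f (Φ p))
      ((hΦm.integrable_comp_emb hemb).2 hint),
    ← integral_indicator (measurableSet_cornerSimplex n)]
  congr 1
  ext z
  by_cases hz : z ∈ cornerSimplex n
  · rw [Set.indicator_of_mem hz, intervalIntegral.integral_of_le (by linarith [hz.2]),
      ← integral_Icc_eq_integral_Ioc, ← integral_indicator measurableSet_Icc]
    congr 1
    ext t
    by_cases ht : t ∈ Set.Icc 0 (1 - ∑ j, z j)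
    · rw [Set.indicator_of_mem ht, Set.indicator_of_mem ((hmem t z).2 ⟨hz, ht⟩)]
    · rw [Set.indicator_of_notMem ht,
        Set.indicator_of_notMem fun h => ht ((hmem t z).1 h).2]
  · rw [Set.indicator_of_notMem hz]
    have : ∀ t, (cornerSimplex (n + 1)).indicator f (Φ (t, z)) = 0 := fun t =>
      Set.indicator_of_notMem (fun h => hz ((hmem t z).1 h).1) _
    simp [this]

/-- The divergence theorem for the derivative `g'` of `g` along the edge from `e 0` to `e 1`,
pulled back to the reference simplex: only the faces opposite to these two vertices contribute. -/
theorem setIntegral_edge_deriv {n m : ℕ} (e : Fin (n + 2) → E m) {g g' : E m → ℝ}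
    (hg : Continuous g) (hg' : Continuous g')
    (h : ∀ x (t : ℝ), HasDerivAt (fun t : ℝ => g (x + t • (e 1 - e 0)))
      (g' (x + t • (e 1 - e 0))) t) :
    ∫ y in cornerSimplex (n + 1), g' (simplexParam e y)
      = (∫ z in cornerSimplex n, g (simplexParam (fun j => e j.succ) z))
        - ∫ z in cornerSimplex n, g (simplexParam (fun j => e ((1 : Fin (n + 2)).succAbove j)) z)
          := by
  rw [setIntegral_cornerSimplex_succ (f := fun y => g' (simplexParam e y))
    (hg'.comp (continuous_simplexParam e)), ← integral_sub]
  · congr 1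
    ext z
    set x := simplexParam (fun j => e ((1 : Fin (n + 2)).succAbove j)) z with hx
    have hs : ∀ j : Fin n, (1 : Fin (n + 2)).succAbove j.succ = j.succ.succ := by
      intro j
      rw [← Fin.succ_zero_eq_one, Fin.succ_succAbove_succ, Fin.zero_succAbove]
    have h0 : (1 : Fin (n + 2)).succAbove 0 = 0 := by
      rw [← Fin.succ_zero_eq_one, Fin.succ_succAbove_zero]
    have hp : ∀ t : ℝ, simplexParam e (WithLp.toLp 2 (Fin.cons t fun j => z j))
        = x + t • (e 1 - e 0) := by
      intro t
      rw [hx, simplexParam, edgeMap_apply, Fin.sum_univ_succ, simplexParam, edgeMap_apply]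
      simp only [Fin.cons_zero, Fin.cons_succ, Fin.succ_zero_eq_one, hs, h0]
      abel
    simp only [hp]
    rw [intervalIntegral.integral_eq_sub_of_hasDerivAt (fun t _ => h x t)
      ((hg'.comp (by fun_prop)).intervalIntegrable _ _)]
    congr 2
    · rw [← hp, simplexParam_eq, simplexParam_eq]
      simp only [Fin.sum_univ_succ, Fin.cons_zero, Fin.cons_succ, Fin.succ_zero_eq_one]
      simp
    · simp
  · exact (hg.comp (continuous_simplexParam _)).continuousOn.integrableOn_compact
      (isCompact_cornerSimplex n)
  · exact (hg.comp (continuous_simplexParam _)).continuousOn.integrableOn_compact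
      (isCompact_cornerSimplex n)

/-! ### The divergence theorem on a simplex -/

/-- The derivative of a polynomial `Q` in the direction `u`. -/
noncomputable def dirDeriv {d : ℕ} (Q : MvPolynomial (Fin d) ℝ) (u x : E d) : ℝ :=
  ∑ r, u r * polyVal (MvPolynomial.pderiv r Q) x

theorem hasDerivAt_polyVal {d : ℕ} (Q : MvPolynomial (Fin d) ℝ) (u x : E d) (t : ℝ) :
    HasDerivAt (fun t : ℝ => polyVal Q (x + t • u)) (dirDeriv Q u (x + t • u)) t := by
  induction Q using MvPolynomial.induction_on with
  | C a =>
    simp only [polyVal, dirDeriv, MvPolynomial.eval_C, MvPolynomial.pderiv_C, map_zero, mul_zero,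
      Finset.sum_const_zero]
    exact hasDerivAt_const t a
  | add p q hp hq =>
    have hval : ∀ y, polyVal (p + q) y = polyVal p y + polyVal q y := fun y => map_add _ p q
    simp only [hval]
    refine (hp.add hq).congr_deriv ?_
    simp [dirDeriv, polyVal, mul_add, Finset.sum_add_distrib]
  | mul_X p i hp =>
    have hX : HasDerivAt (fun t : ℝ => x i + t * u i) (u i) t := by
      simpa using ((hasDerivAt_id t).mul_const (u i)).const_add (x i)
    have hval : ∀ s : ℝ, polyVal (p * MvPolynomial.X i) (x + s • u)
        = polyVal p (x + s • u) * (x i + s * u i) := fun s => by simp [polyVal]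
    simp only [hval]
    refine (hp.mul hX).congr_deriv ?_
    · simp only [dirDeriv, polyVal, Derivation.leibniz, MvPolynomial.pderiv_X, map_add,
        smul_eq_mul, map_mul, MvPolynomial.eval_X, mul_add, Finset.sum_add_distrib]
      rw [add_comm]
      congr 1
      · rw [Finset.sum_eq_single i]
        · simp [mul_comm]
        · intro r _ hr
          simp [hr]
        · simp
      · rw [← mul_add, Finset.sum_mul]
        refine Finset.sum_congr rfl fun r _ => ?_
        simp only [PiLp.add_apply, PiLp.smul_apply, smul_eq_mul]
        ring

theorem continuous_dirDeriv {d : ℕ} (Q : MvPolynomial (Fin d) ℝ) (u : E d) :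
    Continuous (dirDeriv Q u) :=
  continuous_finsetSum _ fun _ _ => continuous_const.mul (polyVal_continuous _)

/-- `K` is the vertex set of a nondegenerate simplex of full dimension. -/
structure IsCell {n : ℕ} (K : Finset (E (n + 1))) : Prop where
  indep : AffineIndependent ℝ ((↑) : K → E (n + 1))
  card : K.card = n + 2

/-- The ratio between the volumes of the reference simplices of dimensions `n` and `n + 1`. -/
noncomputable def cornerRatio (n : ℕ) : ℝ := cornerVolume n / cornerVolume (n + 1)

theorem cornerRatio_pos (n : ℕ) : 0 < cornerRatio n :=
  div_pos (cornerVolume_pos _) (cornerVolume_pos _)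

theorem setAverage_convexHull {n m : ℕ} {e : Fin (n + 1) → E m} (he : AffineIndependent ℝ e)
    (f : E m → ℝ) :
    ⨍ x in convexHull ℝ (Set.range e), f x ∂(μHE[n] : Measure (E m))
      = (∫ y in cornerSimplex n, f (simplexParam e y)) / cornerVolume n := by
  have h1 := normDet_edgeMap_pos he
  have h2 := cornerVolume_pos n
  rw [setAverage_eq, hausdorffMeasure_convexHull, setIntegral_convexHull he, smul_eq_mul]
  field_simp

theorem affineIndependent_of_injective {n m : ℕ} {K : Finset (E m)}
    (hK : AffineIndependent ℝ ((↑) : K → E m)) {e : Fin n → E m} (hi : Function.Injective e)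
    (hr : ∀ j, e j ∈ K) : AffineIndependent ℝ e :=
  hK.comp_embedding ⟨fun j => (⟨e j, hr j⟩ : K), fun _ _ h => hi (congrArg Subtype.val h)⟩

theorem exists_enumeration {α : Type*} (F : Finset α) {k : ℕ} (h : F.card = k) :
    ∃ e : Fin k → α, Function.Injective e ∧ Set.range e = F := by
  subst h
  refine ⟨fun j => (F.equivFin.symm j : α), fun a b hab => ?_, ?_⟩
  · simpa using Subtype.ext hab
  · ext x
    constructor
    · rintro ⟨j, rfl⟩
      exact (F.equivFin.symm j).2
    · intro hx
      exact ⟨F.equivFin ⟨x, hx⟩, by simp⟩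

/-- The divergence theorem for the derivative along the edge from `b` to `a`: the other faces are
parallel to this edge. -/
theorem IsCell.setIntegral_dirDeriv {n : ℕ} [DecidableEq (E (n + 1))]
    {K : Finset (E (n + 1))} (hK : IsCell K) {a b : E (n + 1)} (ha : a ∈ K)
    (hb : b ∈ K) (hab : a ≠ b)
    (Q : MvPolynomial (Fin (n + 1)) ℝ) :
    ∫ x in hull K, dirDeriv Q (a - b) x
      = volume.real (hull K) * cornerRatio n *
        ((⨍ x in hull (K.erase b), polyVal Q x ∂(μHE[n] : Measure (E (n + 1))))
          - ⨍ x in hull (K.erase a), polyVal Q x ∂(μHE[n] : Measure (E (n + 1)))) := by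
  have hcard : ((K.erase b).erase a).card = n := by
    rw [Finset.card_erase_of_mem (Finset.mem_erase.2 ⟨hab, ha⟩), Finset.card_erase_of_mem hb,
      hK.card]
    rfl
  obtain ⟨f, hfi, hfr⟩ := exists_enumeration _ hcard
  have hf : ∀ j, f j ≠ a ∧ f j ≠ b ∧ f j ∈ K := by
    intro j
    have : f j ∈ ((K.erase b).erase a : Finset _) := by
      rw [← Finset.mem_coe, ← hfr]; exact ⟨j, rfl⟩
    simpa using this
  set e : Fin (n + 2) → E (n + 1) := Fin.cons b (Fin.cons a f) with he
  have hs : ∀ j : Fin n, (1 : Fin (n + 2)).succAbove j.succ = j.succ.succ := by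
    intro j
    rw [← Fin.succ_zero_eq_one, Fin.succ_succAbove_succ, Fin.zero_succAbove]
  have h0 : (1 : Fin (n + 2)).succAbove 0 = 0 := by
    rw [← Fin.succ_zero_eq_one, Fin.succ_succAbove_zero]
  have hei : Function.Injective e := by
    rw [he, Fin.cons_injective_iff, Fin.cons_injective_iff]
    refine ⟨?_, ?_, hfi⟩
    · rintro ⟨j, hj⟩
      revert hj
      refine Fin.cases (fun hj => hab hj) (fun i hj => (hf i).2.1 hj) j
    · rintro ⟨j, hj⟩
      exact (hf j).1 hj
  have hrf : Set.range f = ((K : Set (E (n + 1))) \ {b}) \ {a} := by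
    rw [hfr]; simp
  have her : Set.range e = K := by
    rw [he, Fin.range_cons, Fin.range_cons, hrf]
    ext x
    simp only [Set.mem_insert_iff, Set.mem_sdiff, Finset.mem_coe, Set.mem_singleton_iff]
    constructor
    · rintro (rfl | rfl | h)
      exacts [hb, ha, h.1.1]
    · intro hx
      by_cases h1 : x = b
      · exact Or.inl h1
      · by_cases h2 : x = a
        · exact Or.inr (Or.inl h2)
        · exact Or.inr (Or.inr ⟨⟨hx, h1⟩, h2⟩)
  have hind : ∀ {k : ℕ} {e' : Fin k → E (n + 1)}, Function.Injective e' → (∀ j, e' j ∈ K) →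
      AffineIndependent ℝ e' := fun h1 h2 => affineIndependent_of_injective hK.indep h1 h2
  have hmem : ∀ j, e j ∈ K := fun j => by
    rw [← Finset.mem_coe, ← her]; exact ⟨j, rfl⟩
  have he_ind : AffineIndependent ℝ e := hind hei hmem
  have h1r : Set.range (fun j : Fin (n + 1) => e j.succ) = ((K.erase b : Finset _) : Set _) := by
    have : (fun j : Fin (n + 1) => e j.succ) = (Fin.cons a f : Fin (n + 1) → E (n + 1)) := rfl
    rw [this, Fin.range_cons, hrf]
    ext x
    simp only [Set.mem_insert_iff, Set.mem_sdiff, Finset.mem_coe, Set.mem_singleton_iff,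
      Finset.mem_erase]
    constructor
    · rintro (rfl | h)
      exacts [⟨hab, ha⟩, ⟨h.1.2, h.1.1⟩]
    · rintro ⟨h1, h2⟩
      by_cases h3 : x = a
      · exact Or.inl h3
      · exact Or.inr ⟨⟨h2, h1⟩, h3⟩
  have h2r : Set.range (fun j : Fin (n + 1) => e ((1 : Fin (n + 2)).succAbove j))
      = ((K.erase a : Finset _) : Set _) := by
    have : (fun j : Fin (n + 1) => e ((1 : Fin (n + 2)).succAbove j))
        = (Fin.cons b f : Fin (n + 1) → E (n + 1)) := by
      funext j
      refine Fin.cases ?_ (fun i => ?_) j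
      · rw [h0]; rfl
      · rw [hs]; rfl
    rw [this, Fin.range_cons, hrf]
    ext x
    simp only [Set.mem_insert_iff, Set.mem_sdiff, Finset.mem_coe, Set.mem_singleton_iff,
      Finset.mem_erase]
    constructor
    · rintro (rfl | h)
      exacts [⟨hab.symm, hb⟩, ⟨h.2, h.1.1⟩]
    · rintro ⟨h1, h2⟩
      by_cases h3 : x = b
      · exact Or.inl h3
      · exact Or.inr ⟨⟨h2, h3⟩, h1⟩
  have hvol : (volume : Measure (E (n + 1))) = μHE[n + 1] :=
    (EuclideanSpace.euclideanHausdorffMeasure_eq_volume (n + 1)).symm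
  have hA := setAverage_convexHull (e := fun j : Fin (n + 1) => e j.succ)
    (hind (hei.comp (Fin.succ_injective _)) fun j => hmem _) (polyVal Q)
  have hB := setAverage_convexHull
    (e := fun j : Fin (n + 1) => e ((1 : Fin (n + 2)).succAbove j))
    (hind (hei.comp Fin.succAbove_right_injective) fun j => hmem _) (polyVal Q)
  rw [h1r] at hA
  rw [h2r] at hB
  have hdiv := setIntegral_edge_deriv e (polyVal_continuous Q) (continuous_dirDeriv Q (a - b))
    (fun x t => hasDerivAt_polyVal Q (a - b) x t)
  have hI := setIntegral_convexHull he_ind (dirDeriv Q (a - b))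
  have hV := hausdorffMeasure_convexHull e
  rw [her, ← hvol] at hI hV
  rw [hA, hB, hI, hV, hdiv, cornerRatio]
  have := cornerVolume_pos n
  have := cornerVolume_pos (n + 1)
  field_simp

theorem IsCell.affineSpan_eq_top {n : ℕ} {K : Finset (E (n + 1))} (hK : IsCell K) :
    affineSpan ℝ (Set.range ((↑) : K → E (n + 1))) = ⊤ := by
  rw [hK.indep.affineSpan_eq_top_iff_card_eq_finrank_add_one]
  simp [hK.card]

/-- The vertices of a cell as an affine basis. -/
noncomputable def IsCell.basis {n : ℕ} {K : Finset (E (n + 1))} (hK : IsCell K) :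
    AffineBasis K ℝ (E (n + 1)) := ⟨(↑), hK.indep, hK.affineSpan_eq_top⟩

theorem IsCell.exists_weights {n : ℕ} {K : Finset (E (n + 1))} (hK : IsCell K) (x : E (n + 1)) :
    ∃ w : E (n + 1) → ℝ, ∑ j ∈ K, w j = 1 ∧ ∑ j ∈ K, w j • j = x := by
  classical
  refine ⟨fun y => if h : y ∈ K then hK.basis.coord ⟨y, h⟩ x else 0, ?_, ?_⟩
  · rw [← Finset.sum_coe_sort]
    simp only [Finset.coe_mem, dite_true]
    exact hK.basis.sum_coord_apply_eq_one x
  · rw [← Finset.sum_coe_sort]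
    simp only [Finset.coe_mem, dite_true]
    exact hK.basis.linear_combination_coord_eq_self x

/-- The divergence theorem on a simplex: the outer normal to the face opposite to the vertex `a`,
scaled by its area, is a multiple of the gradient `ℓ` of the barycentric coordinate of `a`. -/
theorem IsCell.setIntegral_pderiv {n : ℕ} {K : Finset (E (n + 1))} (hK : IsCell K)
    (i : Fin (n + 1)) [DecidableEq (E (n + 1))] :
    ∃ c : E (n + 1) → ℝ,
      (∀ a ∈ K, ∃ ℓ : E (n + 1) →ₗ[ℝ] ℝ, (∀ f ∈ K.erase a, ℓ (a - f) = 1) ∧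
        c a = -(volume.real (hull K) * cornerRatio n * ℓ (EuclideanSpace.single i 1))) ∧
      ∀ Q : MvPolynomial (Fin (n + 1)) ℝ,
        ∫ x in hull K, polyVal (MvPolynomial.pderiv i Q) x
          = ∑ a ∈ K, c a *
              ⨍ x in hull (K.erase a), polyVal Q x ∂(μHE[n] : Measure (E (n + 1))) := by
  set u : E (n + 1) := EuclideanSpace.single i 1 with hu
  set w : E (n + 1) → ℝ := fun y => if h : y ∈ K then (hK.basis.coord ⟨y, h⟩).linear u else 0
    with hw
  have hwsub : ∀ y : K, w y = hK.basis.coord y u - hK.basis.coord y 0 := by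
    intro y
    simp only [hw, Finset.coe_mem, dite_true]
    simpa using (hK.basis.coord y).linearMap_vsub u 0
  have hw0 : ∑ j ∈ K, w j = 0 := by
    rw [← Finset.sum_coe_sort]
    simp only [hwsub, Finset.sum_sub_distrib, hK.basis.sum_coord_apply_eq_one, sub_self]
  have hwu : ∑ j ∈ K, w j • j = u := by
    rw [← Finset.sum_coe_sort]
    simp only [hwsub, sub_smul, Finset.sum_sub_distrib]
    have h1 := hK.basis.linear_combination_coord_eq_self u
    have h2 := hK.basis.linear_combination_coord_eq_self (0 : E (n + 1))
    change ∑ j : K, hK.basis.coord j u • (j : E (n + 1)) = u at h1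
    change ∑ j : K, hK.basis.coord j 0 • (j : E (n + 1)) = 0 at h2
    rw [h1, h2, sub_zero]
  refine ⟨fun a => -(volume.real (hull K) * cornerRatio n * w a), fun a ha => ?_, fun Q => ?_⟩
  · refine ⟨(hK.basis.coord ⟨a, ha⟩).linear, fun f hf => ?_, by simp [hw, ha]⟩
    obtain ⟨hfa, hfK⟩ := Finset.mem_erase.1 hf
    have h := (hK.basis.coord ⟨a, ha⟩).linearMap_vsub a f
    have h1 : hK.basis.coord ⟨a, ha⟩ a = 1 := hK.basis.coord_apply_eq ⟨a, ha⟩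
    have h2 : hK.basis.coord ⟨a, ha⟩ f = 0 :=
      hK.basis.coord_apply_ne (i := ⟨a, ha⟩) (j := ⟨f, hfK⟩) (fun h => hfa (by
        simpa using (congrArg Subtype.val h).symm))
    rw [h1, h2] at h
    simpa using h
  · obtain ⟨b, hb⟩ : K.Nonempty := Finset.card_pos.1 (by rw [hK.card]; omega)
    have hsplit : ∀ φ : E (n + 1) → ℝ, ∑ j ∈ K, φ j = φ b + ∑ j ∈ K.erase b, φ j := fun φ =>
      (Finset.add_sum_erase K φ hb).symm
    have hpt : ∀ x, polyVal (MvPolynomial.pderiv i Q) x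
        = ∑ j ∈ K.erase b, w j * dirDeriv Q (j - b) x := by
      intro x
      have h1 : polyVal (MvPolynomial.pderiv i Q) x = dirDeriv Q u x := by
        simp [dirDeriv, hu]
      have h2 : u = ∑ j ∈ K.erase b, w j • (j - b) := by
        have h3 : ∑ j ∈ K, w j • (j - b) = u := by
          simp only [smul_sub, Finset.sum_sub_distrib, hwu, ← Finset.sum_smul, hw0, zero_smul,
            sub_zero]
        rw [← h3, ← Finset.add_sum_erase K _ hb]
        simp
      have h4 : dirDeriv Q u x = dirDeriv Q (∑ j ∈ K.erase b, w j • (j - b)) x := by rw [← h2]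
      rw [h1, h4]
      simp only [dirDeriv, Finset.mul_sum]
      rw [Finset.sum_comm]
      refine Finset.sum_congr rfl fun r _ => ?_
      simp only [WithLp.ofLp_sum, Finset.sum_apply, PiLp.smul_apply, smul_eq_mul, Finset.sum_mul]
      exact Finset.sum_congr rfl fun j _ => by ring
    have hcomp : IsCompact (hull K) := K.finite_toSet.isCompact_convexHull (𝕜 := ℝ)
    simp only [hpt]
    have hint : ∀ j ∈ K.erase b,
        IntegrableOn (fun x => w j * dirDeriv Q (j - b) x) (hull K) := fun j _ =>
      (continuous_const.mul (continuous_dirDeriv Q (j - b))).continuousOn.integrableOn_compact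
        hcomp
    rw [integral_finsetSum _ hint]
    have hterm : ∀ j ∈ K.erase b, ∫ x in hull K, w j * dirDeriv Q (j - b) x
        = w j * (volume.real (hull K) * cornerRatio n *
        ((⨍ x in hull (K.erase b), polyVal Q x ∂(μHE[n] : Measure (E (n + 1))))
          - ⨍ x in hull (K.erase j), polyVal Q x ∂(μHE[n] : Measure (E (n + 1))))) := by
      intro j hj
      obtain ⟨hjb, hjK⟩ := Finset.mem_erase.1 hj
      rw [integral_const_mul]
      congr 1
      exact hK.setIntegral_dirDeriv hjK hb hjb Q
    rw [Finset.sum_congr rfl hterm, hsplit]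
    rw [hsplit] at hw0
    have hwb : w b = -∑ j ∈ K.erase b, w j := by linarith
    rw [hwb]
    simp only [mul_sub, Finset.sum_sub_distrib, neg_mul, Finset.sum_neg_distrib, mul_neg, neg_neg]
    rw [sub_eq_add_neg, ← Finset.sum_mul]
    congr 1
    · ring
    · rw [← Finset.sum_neg_distrib, ← Finset.sum_neg_distrib]
      exact Finset.sum_congr rfl fun j _ => by ring

/-! ### Areas and normals of the faces of a simplex -/

theorem _root_.LipschitzWith.euclideanHausdorffMeasure_image_le {X Y : Type*}
    [MetricSpace X] [MeasurableSpace X] [BorelSpace X] [MetricSpace Y] [MeasurableSpace Y]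
    [BorelSpace Y] {L : NNReal} {f : X → Y} (hf : LipschitzWith L f) (n : ℕ) (s : Set X) :
    (μHE[n] : Measure Y) (f '' s) ≤ (L : ℝ≥0∞) ^ n * (μHE[n] : Measure X) s := by
  have h := hf.hausdorffMeasure_image_le (d := n) (by positivity) s
  rw [ENNReal.rpow_natCast] at h
  simp only [Measure.euclideanHausdorffMeasure_def, Measure.smul_apply, ENNReal.smul_def,
    smul_eq_mul]
  calc _ ≤ _ := mul_le_mul_right h _
    _ = _ := by ring

/-- The matrix whose columns are the edges that issue from the vertex `e 0`. -/
def edgeMatrix {n : ℕ} (e : Fin (n + 1) → E n) : Matrix (Fin n) (Fin n) ℝ :=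
  Matrix.of fun r j => (e j.succ - e 0) r

theorem normDet_edgeMap_eq_abs_det {n : ℕ} (e : Fin (n + 1) → E n) :
    (edgeMap e).normDet = |(edgeMatrix e).det| := by
  rw [LinearMap.normDet_eq_norm_det_toMatrix _ (EuclideanSpace.basisFun (Fin n) ℝ)
    (EuclideanSpace.basisFun (Fin n) ℝ), Real.norm_eq_abs]
  congr 2
  ext r j
  simp [LinearMap.toMatrix_apply, edgeMap_apply, edgeMatrix, ite_smul]

/-- The edge matrix of the face with vertices `f`, with the `i`-th row removed. -/
def faceMinor {n : ℕ} (f : Fin (n + 1) → E (n + 1)) (i : Fin (n + 1)) :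
    Matrix (Fin n) (Fin n) ℝ :=
  Matrix.of fun r j => (f j.succ - f 0) (i.succAbove r)

/-- The orthogonal projection along the `i`-th coordinate axis does not increase areas. -/
theorem abs_det_faceMinor_le {n : ℕ} (f : Fin (n + 1) → E (n + 1)) (i : Fin (n + 1)) :
    |(faceMinor f i).det| ≤ (edgeMap f).normDet := by
  set π : E (n + 1) → E n := fun x => WithLp.toLp 2 fun r => x (i.succAbove r) with hπ
  have hL : LipschitzWith 1 π := by
    refine LipschitzWith.of_dist_le_mul fun x y => ?_
    rw [NNReal.coe_one, one_mul, EuclideanSpace.dist_eq, EuclideanSpace.dist_eq]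
    apply Real.sqrt_le_sqrt
    rw [Fin.sum_univ_succAbove _ i]
    simp only [hπ]
    linarith [sq_nonneg (dist (x i) (y i))]
  set g : Fin (n + 1) → E n := fun j => π (f j) with hg
  have hcomp : ∀ y, edgeMap g y = π (edgeMap f y) := by
    intro y
    ext r
    simp [edgeMap_apply, hg, hπ]
  have hdet : (edgeMap g).normDet = |(faceMinor f i).det| := by
    rw [normDet_edgeMap_eq_abs_det]
    congr 2
  have h1 : ∀ {m : ℕ} (h : E n →ₗ[ℝ] E m), (μHE[n] : Measure (E m)) (h '' cornerSimplex n)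
      = ENNReal.ofReal h.normDet * volume (cornerSimplex n) := by
    intro m h
    have := h.euclideanHausdorffMeasure_image_eq_normDet_mul_volume (cornerSimplex n)
    rwa [finrank_euclideanSpace_fin] at this
  have h2 : edgeMap g '' cornerSimplex n = π '' (edgeMap f '' cornerSimplex n) := by
    rw [Set.image_image]
    exact Set.image_congr fun y _ => hcomp y
  have h3 := hL.euclideanHausdorffMeasure_image_le n (edgeMap f '' cornerSimplex n)
  rw [← h2, h1, h1, ENNReal.coe_one, one_pow, one_mul] at h3
  have h4 : volume (cornerSimplex n) ≠ 0 :=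
    (Measure.measure_pos_of_nonempty_interior _ (interior_cornerSimplex_nonempty n)).ne'
  have h5 : volume (cornerSimplex n) ≠ ⊤ := (isCompact_cornerSimplex n).measure_lt_top.ne
  rw [ENNReal.mul_le_mul_iff_left h4 h5, hdet,
    ENNReal.ofReal_le_ofReal_iff (LinearMap.normDet_nonneg _)] at h3
  exact h3

theorem normDet_edgeMap_le {n m : ℕ} (e : Fin (n + 1) → E m) {D : ℝ} (hD : 0 ≤ D)
    (h : ∀ j : Fin n, ‖e j.succ - e 0‖ ≤ D) : (edgeMap e).normDet ≤ (n * D) ^ n := by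
  have hL : LipschitzWith (Real.toNNReal (n * D)) (edgeMap e) := by
    refine AddMonoidHomClass.lipschitz_of_bound (edgeMap e) _ fun y => ?_
    rw [edgeMap_apply]
    calc ‖∑ j, y j • (e j.succ - e 0)‖ ≤ ∑ j : Fin n, ‖y‖ * D := by
          refine norm_sum_le_of_le _ fun j _ => ?_
          rw [norm_smul]
          exact mul_le_mul (PiLp.norm_apply_le y j) (h j) (norm_nonneg _) (norm_nonneg _)
      _ = n * D * ‖y‖ := by simp; ring
  have h1 := hL.euclideanHausdorffMeasure_image_le n (cornerSimplex n)
  have h2 := (edgeMap e).euclideanHausdorffMeasure_image_eq_normDet_mul_volume (cornerSimplex n)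
  rw [finrank_euclideanSpace_fin] at h2
  rw [h2, EuclideanSpace.euclideanHausdorffMeasure_eq_volume] at h1
  have h4 : volume (cornerSimplex n) ≠ 0 :=
    (Measure.measure_pos_of_nonempty_interior _ (interior_cornerSimplex_nonempty n)).ne'
  have h5 : volume (cornerSimplex n) ≠ ⊤ := (isCompact_cornerSimplex n).measure_lt_top.ne
  rw [ENNReal.mul_le_mul_iff_left h4 h5, ENNReal.ofNNReal_toNNReal,
    ← ENNReal.ofReal_pow (by positivity), ENNReal.ofReal_le_ofReal_iff (by positivity)] at h1
  exact h1

/-- The vertices of the simplex spanned by a face `f` and a further vertex `a`. -/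
def coneVertices {n : ℕ} (f : Fin (n + 1) → E (n + 1)) (a : E (n + 1)) :
    Fin (n + 2) → E (n + 1) :=
  Fin.cons (f 0) (Fin.cons a fun j => f j.succ)

theorem det_edgeMatrix_coneVertices {n : ℕ} (f : Fin (n + 1) → E (n + 1)) (a : E (n + 1)) :
    (edgeMatrix (coneVertices f a)).det
      = ∑ i : Fin (n + 1), (a - f 0) i * ((-1) ^ (i : ℕ) * (faceMinor f i).det) := by
  rw [Matrix.det_succ_column_zero]
  refine Finset.sum_congr rfl fun i _ => ?_
  have h : (edgeMatrix (coneVertices f a)).submatrix i.succAbove Fin.succ = faceMinor f i := rfl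
  have h2 : edgeMatrix (coneVertices f a) i 0 = (a - f 0) i := rfl
  rw [h, h2]
  ring

/-- Cramer's rule for the gradient `ℓ` of the barycentric coordinate of the vertex `a`. -/
theorem det_mul_barycentric_grad {n : ℕ} (f : Fin (n + 1) → E (n + 1)) (a : E (n + 1))
    (ℓ : E (n + 1) →ₗ[ℝ] ℝ) (hℓ : ∀ j, ℓ (a - f j) = 1) (i : Fin (n + 1)) :
    (edgeMatrix (coneVertices f a)).det * ℓ (EuclideanSpace.single i 1)
      = (-1) ^ (i : ℕ) * (faceMinor f i).det := by
  set M := edgeMatrix (coneVertices f a) with hM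
  set w : Fin (n + 1) → ℝ := fun r => ℓ (EuclideanSpace.single r 1) with hw
  have hℓw : ∀ x : E (n + 1), ℓ x = ∑ r, w r * x r := by
    intro x
    have hx : x = ∑ r, x r • (EuclideanSpace.single r 1 : E (n + 1)) := by
      ext s
      simp [Pi.single_apply]
    conv_lhs => rw [hx]
    simp [hw, mul_comm]
  have hwM : Matrix.vecMul w M = Pi.single 0 1 := by
    ext j
    have h1 : Matrix.vecMul w M j = ℓ (coneVertices f a j.succ - f 0) := by
      rw [hℓw]
      rfl
    rw [h1]
    refine Fin.cases ?_ (fun k => ?_) j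
    · simpa [coneVertices] using hℓ 0
    · have h2 : coneVertices f a k.succ.succ - f 0 = (a - f 0) - (a - f k.succ) := by
        simp [coneVertices]
      rw [h2, map_sub, hℓ, hℓ]
      simp
  have h3 : Matrix.vecMul w (M * M.adjugate) = Matrix.vecMul (Pi.single 0 1) M.adjugate := by
    rw [← Matrix.vecMul_vecMul, hwM]
  have h4 := congrFun h3 i
  rw [Matrix.mul_adjugate, Matrix.vecMul_smul, Matrix.vecMul_one, Matrix.single_one_vecMul,
    Matrix.row_apply, Matrix.adjugate_fin_succ_eq_det_submatrix] at h4
  simpa [faceMinor, M, edgeMatrix, coneVertices, Matrix.submatrix] using h4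

/-- An enumeration of the vertices of a face, with the data of the adjacent cells expressed in
terms of determinants. -/
theorem exists_face_enumeration {n : ℕ} [DecidableEq (E (n + 1))] {F : Finset (E (n + 1))}
    (hF : F.card = n + 1) :
    ∃ f : Fin (n + 1) → E (n + 1), (∀ j, f j ∈ F) ∧
      (μHE[n] : Measure (E (n + 1))).real (hull F) = (edgeMap f).normDet * cornerVolume n ∧
      ∀ a ∉ F, IsCell (insert a F) → (edgeMatrix (coneVertices f a)).det ≠ 0 ∧
        volume.real (hull (insert a F)) * cornerRatio n
          = |(edgeMatrix (coneVertices f a)).det| * cornerVolume n := by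
  obtain ⟨f, hfi, hfr⟩ := exists_enumeration F hF
  have hfF : ∀ j, f j ∈ F := fun j => by
    rw [← Finset.mem_coe, ← hfr]; exact ⟨j, rfl⟩
  refine ⟨f, hfF, ?_, fun a ha hK => ?_⟩
  · rw [← hausdorffMeasure_convexHull, hfr]
  · have hr : Set.range (coneVertices f a) = ((insert a F : Finset _) : Set (E (n + 1))) := by
      have hf : Set.range f = insert (f 0) (Set.range fun j : Fin n => f j.succ) := by
        rw [← Fin.range_cons]
        congr 1
        funext j
        refine Fin.cases rfl (fun i => rfl) j
      rw [coneVertices, Fin.range_cons, Fin.range_cons, Set.insert_comm, ← hf, hfr]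
      simp
    have hinj : Function.Injective (coneVertices f a) := by
      rw [coneVertices, Fin.cons_injective_iff, Fin.cons_injective_iff]
      refine ⟨?_, ?_, hfi.comp (Fin.succ_injective _)⟩
      · rintro ⟨j, hj⟩
        revert hj
        refine Fin.cases (fun hj => ?_) (fun i hj => ?_) j
        · rw [Fin.cons_zero] at hj
          exact ha (hj ▸ hfF 0)
        · rw [Fin.cons_succ] at hj
          exact (Fin.succ_ne_zero i) (hfi hj)
      · rintro ⟨j, hj⟩
        exact ha (hj ▸ hfF j.succ)
    have hind : AffineIndependent ℝ (coneVertices f a) :=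
      affineIndependent_of_injective hK.indep hinj fun j => by
        rw [← Finset.mem_coe, ← hr]; exact ⟨j, rfl⟩
    have hpos := normDet_edgeMap_pos hind
    have hvol : (volume : Measure (E (n + 1))) = μHE[n + 1] :=
      (EuclideanSpace.euclideanHausdorffMeasure_eq_volume (n + 1)).symm
    have hV := hausdorffMeasure_convexHull (coneVertices f a)
    rw [hr, ← hvol, normDet_edgeMap_eq_abs_det] at hV
    rw [normDet_edgeMap_eq_abs_det] at hpos
    refine ⟨abs_pos.1 hpos, ?_⟩
    rw [hV, cornerRatio]
    have := cornerVolume_pos (n + 1)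
    field_simp

/-- A component of the outer normal, scaled by the area of the face, is at most this area. -/
theorem abs_flux_le {n : ℕ} [DecidableEq (E (n + 1))] {F : Finset (E (n + 1))}
    (hF : F.card = n + 1) {a : E (n + 1)} (ha : a ∉ F) (hK : IsCell (insert a F))
    (ℓ : E (n + 1) →ₗ[ℝ] ℝ)
    (hℓ : ∀ f ∈ F, ℓ (a - f) = 1) (i : Fin (n + 1)) :
    |volume.real (hull (insert a F)) * cornerRatio n * ℓ (EuclideanSpace.single i 1)|
      ≤ (μHE[n] : Measure (E (n + 1))).real (hull F) := by
  obtain ⟨f, hfF, hH, hcell⟩ := exists_face_enumeration hF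
  obtain ⟨-, hV⟩ := hcell a ha hK
  have h1 := det_mul_barycentric_grad f a ℓ (fun j => hℓ _ (hfF j)) i
  have h2 := abs_det_faceMinor_le f i
  have h3 := cornerVolume_pos n
  have h4 : |(edgeMatrix (coneVertices f a)).det| * |ℓ (EuclideanSpace.single i 1)|
      = |(faceMinor f i).det| := by
    rw [← abs_mul, h1, abs_mul, abs_pow, abs_neg, abs_one, one_pow, one_mul]
  rw [hV, hH, abs_mul, abs_mul, abs_abs, abs_of_pos h3, mul_right_comm, h4]
  exact mul_le_mul_of_nonneg_right h2 h3.le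

/-- The outer normals to a common face of two cells on opposite sides of this face cancel. -/
theorem flux_antisymm {n : ℕ} [DecidableEq (E (n + 1))] {F : Finset (E (n + 1))}
    (hF : F.card = n + 1) {a b : E (n + 1)} (ha : a ∉ F) (hb : b ∉ F)
    (hKa : IsCell (insert a F)) (hKb : IsCell (insert b F))
    (ℓ ℓ' : E (n + 1) →ₗ[ℝ] ℝ) (hℓ : ∀ f ∈ F, ℓ (a - f) = 1) (hℓ' : ∀ f ∈ F, ℓ' (b - f) = 1)
    (hopp : ∀ f ∈ F, ℓ (b - f) < 0) (i : Fin (n + 1)) :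
    volume.real (hull (insert a F)) * cornerRatio n * ℓ (EuclideanSpace.single i 1)
      = -(volume.real (hull (insert b F)) * cornerRatio n * ℓ' (EuclideanSpace.single i 1)) := by
  obtain ⟨f, hfF, hH, hcell⟩ := exists_face_enumeration hF
  obtain ⟨ha0, hVa⟩ := hcell a ha hKa
  obtain ⟨hb0, hVb⟩ := hcell b hb hKb
  have h1 := det_mul_barycentric_grad f a ℓ fun j => hℓ _ (hfF j)
  have h2 := det_mul_barycentric_grad f b ℓ' (fun j => hℓ' _ (hfF j)) i
  have h3 : (edgeMatrix (coneVertices f b)).det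
      = (edgeMatrix (coneVertices f a)).det * ℓ (b - f 0) := by
    have hx : b - f 0 = ∑ r, (b - f 0) r • (EuclideanSpace.single r 1 : E (n + 1)) := by
      ext s
      simp [Pi.single_apply]
    rw [det_edgeMatrix_coneVertices, hx, map_sum, Finset.mul_sum, ← hx]
    refine Finset.sum_congr rfl fun r _ => ?_
    rw [← h1, map_smul, smul_eq_mul]
    ring
  have hneg := hopp _ (hfF 0)
  rw [hVa, hVb]
  rw [← h1] at h2
  set Da := (edgeMatrix (coneVertices f a)).det
  set Db := (edgeMatrix (coneVertices f b)).det
  rcases lt_or_gt_of_ne ha0 with h | h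
  · have : 0 < Db := h3 ▸ mul_pos_of_neg_of_neg h hneg
    rw [abs_of_neg h, abs_of_pos this]
    linear_combination cornerVolume n * h2
  · have : Db < 0 := h3 ▸ mul_neg_of_pos_of_neg h hneg
    rw [abs_of_neg this, abs_of_pos h]
    linear_combination -cornerVolume n * h2

/-- Two simplices with the common face `F` that meet only in `F` lie on opposite sides of it:
otherwise a combination of the vertices with large weights on `F` is a common point outside `F`. -/
theorem opposite_sides {n : ℕ} [DecidableEq (E (n + 1))] {F : Finset (E (n + 1))} {a b : E (n + 1)}
    (ha : a ∉ F) (hb : b ∉ F) (hKa : IsCell (insert a F))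
    (hinter : hull (insert a F) ∩ hull (insert b F) ⊆ hull F)
    (ℓ ℓ' : E (n + 1) →ₗ[ℝ] ℝ) (hℓ : ∀ f ∈ F, ℓ (a - f) = 1) (hℓ' : ∀ f ∈ F, ℓ' (b - f) = 1) :
    ∀ f ∈ F, ℓ (b - f) < 0 := by
  intro f0 hf0
  by_contra hcon
  rw [not_lt] at hcon
  obtain ⟨w, hw1, hwb⟩ := hKa.exists_weights b
  rw [Finset.sum_insert ha] at hw1 hwb
  -- the weight of `a` in the representation of `b`
  have hwa : w a = ℓ (b - f0) := by
    have h1 : b - f0 = w a • (a - f0) + ∑ j ∈ F, w j • (j - f0) := by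
      have h2 : f0 = (w a + ∑ j ∈ F, w j) • f0 := by rw [hw1, one_smul]
      simp only [smul_sub, Finset.sum_sub_distrib, ← Finset.sum_smul]
      nth_rewrite 1 [← hwb]
      nth_rewrite 1 [h2]
      rw [add_smul]
      abel
    have h3 : ∀ j ∈ F, ℓ (j - f0) = 0 := by
      intro j hj
      have : j - f0 = (a - f0) - (a - j) := by abel
      rw [this, map_sub, hℓ _ hf0, hℓ _ hj, sub_self]
    rw [h1, map_add, map_smul, hℓ _ hf0, map_sum, Finset.sum_eq_zero]
    · simp
    · intro j hj
      rw [map_smul, h3 j hj, smul_zero]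
  obtain ⟨N, hN0, hwN⟩ : ∃ N : ℝ, 0 ≤ N ∧ ∀ j ∈ F, 0 ≤ w j + N := by
    refine ⟨∑ j ∈ F, |w j|, Finset.sum_nonneg fun j _ => abs_nonneg _, fun j hj => ?_⟩
    have h1 : |w j| ≤ ∑ j ∈ F, |w j| := Finset.single_le_sum (f := fun j => |w j|)
      (fun j _ => abs_nonneg _) hj
    linarith [neg_abs_le (w j)]
  obtain ⟨S, hS⟩ : ∃ S : ℝ, S = 1 + F.card * N := ⟨_, rfl⟩
  have hSpos : 0 < S := by
    have : 0 ≤ (F.card : ℝ) * N := mul_nonneg (Nat.cast_nonneg _) hN0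
    rw [hS]
    linarith
  obtain ⟨x, hx⟩ : ∃ x : E (n + 1), x = S⁻¹ • (b + ∑ j ∈ F, N • j) := ⟨_, rfl⟩
  have hxa : x ∈ hull (insert a F) := by
    have h := Finset.centerMass_mem_convexHull (R := ℝ) (insert a F)
      (w := fun j => if j ∈ F then w j + N else w j) (z := id)
      (s := ((insert a F : Finset (E (n + 1))) : Set (E (n + 1)))) ?_ ?_ ?_
    · convert h using 1
      have hs : ∑ j ∈ insert a F, (if j ∈ F then w j + N else w j) = S := by
        rw [Finset.sum_insert ha, if_neg ha, Finset.sum_congr rfl fun j hj => if_pos hj,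
          Finset.sum_add_distrib, ← add_assoc, hw1]
        simp [hS]
      have hv : ∑ j ∈ insert a F, (if j ∈ F then w j + N else w j) • id j
          = b + ∑ j ∈ F, N • j := by
        rw [Finset.sum_insert ha, if_neg ha,
          Finset.sum_congr rfl fun j hj => by rw [if_pos hj]]
        simp only [add_smul, Finset.sum_add_distrib, id]
        rw [← add_assoc, hwb]
      rw [Finset.centerMass, hs, hv, hx]
    · intro j hj
      by_cases hjF : j ∈ F
      · simpa [hjF] using hwN j hjF
      · rw [Finset.mem_insert] at hj
        obtain rfl : j = a := hj.resolve_right hjF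
        simp only [hjF, if_false]
        rw [hwa]
        exact hcon
    · rw [Finset.sum_insert ha, if_neg ha, Finset.sum_congr rfl fun j hj => if_pos hj,
        Finset.sum_add_distrib, ← add_assoc, hw1]
      simp only [Finset.sum_const, nsmul_eq_mul]
      rw [← hS]
      exact hSpos
    · intro j hj
      exact hj
  have hxb : x ∈ hull (insert b F) := by
    have h := Finset.centerMass_mem_convexHull (R := ℝ) (insert b F)
      (w := fun j => if j ∈ F then N else 1) (z := id)
      (s := ((insert b F : Finset (E (n + 1))) : Set (E (n + 1)))) ?_ ?_ ?_
    · convert h using 1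
      have hs : ∑ j ∈ insert b F, (if j ∈ F then N else 1) = S := by
        rw [Finset.sum_insert hb, if_neg hb, Finset.sum_congr rfl fun j hj => if_pos hj]
        simp [hS]
      have hv : ∑ j ∈ insert b F, (if j ∈ F then N else (1 : ℝ)) • id j
          = b + ∑ j ∈ F, N • j := by
        rw [Finset.sum_insert hb, if_neg hb,
          Finset.sum_congr rfl fun j hj => by rw [if_pos hj]]
        simp
      rw [Finset.centerMass, hs, hv, hx]
    · intro j _
      split_ifs
      · exact hN0
      · exact zero_le_one
    · rw [Finset.sum_insert hb, if_neg hb, Finset.sum_congr rfl fun j hj => if_pos hj]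
      simp only [Finset.sum_const, nsmul_eq_mul]
      rw [← hS]
      exact hSpos
    · intro j hj
      exact hj
  have hxF := hinter ⟨hxa, hxb⟩
  -- `ℓ'` vanishes on the plane of `F`, but not at `x`
  have h3 : ∀ j ∈ F, ℓ' (j - f0) = 0 := by
    intro j hj
    have : j - f0 = (b - f0) - (b - j) := by abel
    rw [this, map_sub, hℓ' _ hf0, hℓ' _ hj, sub_self]
  have hsub : hull F ⊆ {y | ℓ' y = ℓ' f0} := by
    refine convexHull_min (fun j hj => ?_) ?_
    · have := h3 j hj
      rw [map_sub, sub_eq_zero] at this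
      exact this
    · intro y hy z hz s t _ _ hst
      simp only [Set.mem_ofPred_eq] at hy hz ⊢
      rw [map_add, map_smul, map_smul, hy, hz, ← add_smul, hst, one_smul]
  have h4 : ℓ' x = ℓ' f0 := hsub hxF
  have h5 : ℓ' (S • x - S • f0) = 1 := by
    have h6 : S • x - S • f0 = (b - f0) + ∑ j ∈ F, N • (j - f0) := by
      rw [hx, smul_smul, mul_inv_cancel₀ hSpos.ne', one_smul, hS, add_smul, one_smul]
      simp only [smul_sub, Finset.sum_sub_distrib, Finset.sum_const]
      rw [mul_smul, Nat.cast_smul_eq_nsmul]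
      abel
    rw [h6, map_add, hℓ' _ hf0, map_sum, Finset.sum_eq_zero, add_zero]
    intro j hj
    rw [map_smul, h3 j hj, smul_zero]
  rw [map_sub, ℓ'.map_smul S x, ℓ'.map_smul S f0, h4, sub_self] at h5
  exact one_ne_zero h5.symm

/-! ### Inverse and trace inequalities for polynomials on a simplex -/

theorem totalDegree_aeval_le {σ τ : Type*} {g : σ → MvPolynomial τ ℝ}
    (hg : ∀ i, (g i).totalDegree ≤ 1) {P : MvPolynomial σ ℝ} {p : ℕ} (hP : P.totalDegree ≤ p) :
    (MvPolynomial.aeval g P).totalDegree ≤ p := by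
  rw [MvPolynomial.aeval_def, MvPolynomial.eval₂_eq]
  refine MvPolynomial.totalDegree_finsetSum_le fun d hd => ?_
  refine (MvPolynomial.totalDegree_mul _ _).trans ?_
  have h1 : (algebraMap ℝ (MvPolynomial τ ℝ) (P.coeff d)).totalDegree = 0 :=
    MvPolynomial.totalDegree_C _
  rw [h1, zero_add]
  refine (MvPolynomial.totalDegree_finsetProd _ _).trans ?_
  calc ∑ i ∈ d.support, (g i ^ d i).totalDegree ≤ ∑ i ∈ d.support, d i := by
        refine Finset.sum_le_sum fun i _ => (MvPolynomial.totalDegree_pow _ _).trans ?_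
        simpa using Nat.mul_le_mul_left (d i) (hg i)
    _ ≤ P.totalDegree := MvPolynomial.le_totalDegree hd
    _ ≤ p := hP

theorem exists_polyVal_simplexParam {n m p : ℕ} (e : Fin (n + 1) → E m)
    {P : MvPolynomial (Fin m) ℝ} (hP : P.totalDegree ≤ p) :
    ∃ Q : MvPolynomial (Fin n) ℝ, Q.totalDegree ≤ p ∧
      ∀ y, polyVal P (simplexParam e y) = polyVal Q y := by
  refine ⟨MvPolynomial.aeval (fun i => MvPolynomial.C (e 0 i)
    + ∑ j, MvPolynomial.C ((e j.succ - e 0) i) * MvPolynomial.X j) P,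
    totalDegree_aeval_le (fun i => ?_) hP, fun y => ?_⟩
  · refine (MvPolynomial.totalDegree_add _ _).trans (max_le (by simp) ?_)
    refine MvPolynomial.totalDegree_finsetSum_le fun j _ => ?_
    refine (MvPolynomial.totalDegree_mul _ _).trans ?_
    rw [MvPolynomial.totalDegree_C, MvPolynomial.totalDegree_X]
  · have h : ∀ (g : Fin m → MvPolynomial (Fin n) ℝ) (z : Fin n → ℝ),
        MvPolynomial.eval z (MvPolynomial.aeval g P)
          = MvPolynomial.eval (fun i => MvPolynomial.eval z (g i)) P := by
      intro g z
      rw [MvPolynomial.aeval_def, MvPolynomial.algebraMap_eq, MvPolynomial.eval₂_eq,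
        MvPolynomial.eval_eq _ P, map_sum]
      exact Finset.sum_congr rfl fun d _ => by simp
    rw [polyVal, polyVal, h]
    congr 2
    ext i
    simp [simplexParam, edgeMap_apply, mul_comm]

theorem isCompact_hull {d : ℕ} (s : Finset (E d)) : IsCompact (hull s) :=
  s.finite_toSet.isCompact_convexHull (𝕜 := ℝ)

/-- On polynomials of degree at most `p`, the maximum norm on the reference simplex is bounded by
the `L²` norm, since the space of these polynomials is finite dimensional. -/
theorem exists_sup_le_integral (n p : ℕ) :
    ∃ C : ℝ, 0 ≤ C ∧ ∀ Q : MvPolynomial (Fin n) ℝ, Q.totalDegree ≤ p →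
      ∀ y ∈ cornerSimplex n,
        polyVal Q y ^ 2 ≤ C * ∫ z in cornerSimplex n, polyVal Q z ^ 2 := by
  classical
  set W := MvPolynomial.restrictTotalDegree (Fin n) ℝ p
  set b := Module.finBasis ℝ W
  set N := Module.finrank ℝ W
  set β : Fin N → E n → ℝ := fun j => polyVal (b j : MvPolynomial (Fin n) ℝ) with hβ
  have hβc : ∀ j, Continuous (β j) := fun j => polyVal_continuous _
  have hcomp := isCompact_cornerSimplex n
  set q : (Fin N → ℝ) → MvPolynomial (Fin n) ℝ := fun c => ∑ j, c j • (b j : MvPolynomial _ ℝ)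
    with hq
  have hqv : ∀ c y, polyVal (q c) y = ∑ j, c j * β j y := by
    intro c y
    simp [polyVal, hq, hβ, MvPolynomial.smul_eval]
  set Φ : (Fin N → ℝ) → ℝ := fun c => ∫ z in cornerSimplex n, polyVal (q c) z ^ 2 with hΦ
  have hΦ' : ∀ c, Φ c = ∑ i, ∑ j, c i * c j * ∫ z in cornerSimplex n, β i z * β j z := by
    intro c
    have hpt : ∀ z, polyVal (q c) z ^ 2 = ∑ i, ∑ j, c i * c j * (β i z * β j z) := by
      intro z
      rw [hqv, sq, Finset.sum_mul_sum]
      exact Finset.sum_congr rfl fun i _ => Finset.sum_congr rfl fun j _ => by ring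
    simp only [hΦ, hpt]
    have hint : ∀ i j, IntegrableOn (fun z => c i * c j * (β i z * β j z)) (cornerSimplex n) :=
      fun i j => (continuous_const.mul ((hβc i).mul (hβc j))).continuousOn.integrableOn_compact
        hcomp
    rw [integral_finsetSum _ fun i _ => integrable_finsetSum _ fun j _ => hint i j]
    refine Finset.sum_congr rfl fun i _ => ?_
    rw [integral_finsetSum _ fun j _ => hint i j]
    exact Finset.sum_congr rfl fun j _ => integral_const_mul _ _
  have hΦc : Continuous Φ := by
    have : Φ = fun c => ∑ i, ∑ j, c i * c j * ∫ z in cornerSimplex n, β i z * β j z :=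
      funext hΦ'
    rw [this]
    fun_prop
  have hΦ0 : ∀ c, 0 ≤ Φ c := fun c => integral_nonneg fun z => sq_nonneg _
  have hΦpos : ∀ c, c ≠ 0 → 0 < Φ c := by
    intro c hc
    refine lt_of_le_of_ne (hΦ0 c) fun h => hc ?_
    have hint : IntegrableOn (fun z => polyVal (q c) z ^ 2) (cornerSimplex n) :=
      ((polyVal_continuous _).pow 2).continuousOn.integrableOn_compact hcomp
    have h1 := (integral_eq_zero_iff_of_nonneg (fun z => sq_nonneg _) hint).1 h.symm
    have h2 : polyVal (q c) =ᵐ[volume.restrict (cornerSimplex n)]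
        polyVal (0 : MvPolynomial (Fin n) ℝ) := by
      filter_upwards [h1] with z hz
      have : polyVal (q c) z = 0 := by simpa using hz
      rw [this]
      simp [polyVal]
    have h3 : q c = 0 := poly_unique (interior_cornerSimplex_nonempty n) h2
    have h4 : ∑ j, c j • b j = 0 := by
      apply Subtype.ext
      simpa [hq] using h3
    ext j
    exact Fintype.linearIndependent_iff.1 b.linearIndependent c h4 j
  -- a lower bound of the Gram form on the unit sphere
  obtain ⟨δ, hδ, hδΦ⟩ : ∃ δ : ℝ, 0 < δ ∧ ∀ c, ‖c‖ = 1 → δ ≤ Φ c := by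
    by_cases hne : (Metric.sphere (0 : Fin N → ℝ) 1).Nonempty
    · obtain ⟨c, hc, hmin⟩ := (isCompact_sphere (0 : Fin N → ℝ) 1).exists_isMinOn hne
        hΦc.continuousOn
      refine ⟨Φ c, hΦpos c ?_, fun c' hc' => hmin (by simpa using hc')⟩
      rintro rfl
      simp at hc
    · refine ⟨1, one_pos, fun c hc => ?_⟩
      exact absurd ⟨c, by simpa using hc⟩ hne
  have hhom : ∀ c, δ * ‖c‖ ^ 2 ≤ Φ c := by
    intro c
    by_cases hc : c = 0
    · subst hc; simpa using hΦ0 0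
    · have hn : 0 < ‖c‖ := norm_pos_iff.2 hc
      have h1 := hδΦ (‖c‖⁻¹ • c) (by rw [norm_smul]; simp [hn.ne'])
      have h2 : Φ (‖c‖⁻¹ • c) = (‖c‖⁻¹) ^ 2 * Φ c := by
        rw [hΦ', hΦ', Finset.mul_sum]
        refine Finset.sum_congr rfl fun i _ => ?_
        rw [Finset.mul_sum]
        refine Finset.sum_congr rfl fun j _ => ?_
        simp only [Pi.smul_apply, smul_eq_mul]
        ring
      rw [h2] at h1
      calc δ * ‖c‖ ^ 2 ≤ (‖c‖⁻¹ ^ 2 * Φ c) * ‖c‖ ^ 2 :=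
            mul_le_mul_of_nonneg_right h1 (sq_nonneg _)
        _ = Φ c := by field_simp
  have hbd : ∀ j, ∃ B, ∀ y ∈ cornerSimplex n, ‖β j y‖ ≤ B := fun j =>
    hcomp.exists_bound_of_continuousOn (hβc j).continuousOn
  choose B hB using hbd
  set S := ∑ j, |B j| with hS
  refine ⟨S ^ 2 / δ, by positivity, fun Q hQ y hy => ?_⟩
  obtain ⟨c, rfl⟩ : ∃ c, q c = Q := by
    have hQW : Q ∈ W := (MvPolynomial.mem_restrictTotalDegree _ _ _).2 hQ
    refine ⟨b.repr ⟨Q, hQW⟩, ?_⟩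
    have := congrArg Subtype.val (b.sum_repr ⟨Q, hQW⟩)
    rw [AddSubmonoidClass.coe_finsetSum] at this
    exact this
  have h1 : |polyVal (q c) y| ≤ ‖c‖ * S := by
    rw [hqv, hS, Finset.mul_sum]
    refine (Finset.abs_sum_le_sum_abs _ _).trans (Finset.sum_le_sum fun j _ => ?_)
    rw [abs_mul]
    exact mul_le_mul (norm_le_pi_norm c j) ((hB j y hy).trans (le_abs_self _)) (abs_nonneg _)
      (norm_nonneg _)
  have h2 : polyVal (q c) y ^ 2 ≤ (‖c‖ * S) ^ 2 := by
    rw [← sq_abs]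
    exact pow_le_pow_left₀ (abs_nonneg _) h1 2
  calc polyVal (q c) y ^ 2 ≤ (‖c‖ * S) ^ 2 := h2
    _ = S ^ 2 / δ * (δ * ‖c‖ ^ 2) := by field_simp
    _ ≤ S ^ 2 / δ * Φ c := mul_le_mul_of_nonneg_left (hhom c) (by positivity)

/-- The constant of the inverse inequality on the reference simplex. -/
noncomputable def inverseConst (n p : ℕ) : ℝ := (exists_sup_le_integral n p).choose

theorem inverseConst_nonneg (n p : ℕ) : 0 ≤ inverseConst n p :=
  (exists_sup_le_integral n p).choose_spec.1

theorem IsCell.exists_enumeration {n : ℕ} {K : Finset (E (n + 1))} (hK : IsCell K) :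
    ∃ e : Fin (n + 2) → E (n + 1), AffineIndependent ℝ e ∧ Set.range e = K := by
  obtain ⟨e, hei, her⟩ := DGFEM.exists_enumeration K hK.card
  exact ⟨e, affineIndependent_of_injective hK.indep hei fun j => by
    rw [← Finset.mem_coe, ← her]; exact ⟨j, rfl⟩, her⟩

theorem IsCell.interior_nonempty {n : ℕ} {K : Finset (E (n + 1))} (hK : IsCell K) :
    (interior (hull K)).Nonempty := by
  rw [interior_convexHull_nonempty_iff_affineSpan_eq_top]
  simpa using hK.affineSpan_eq_top

theorem IsCell.volume_pos {n : ℕ} {K : Finset (E (n + 1))} (hK : IsCell K) :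
    0 < volume.real (hull K) :=
  ENNReal.toReal_pos (Measure.measure_pos_of_nonempty_interior _ hK.interior_nonempty).ne'
    (isCompact_hull K).measure_lt_top.ne

theorem IsCell.sq_polyVal_le {n p : ℕ} {K : Finset (E (n + 1))} (hK : IsCell K)
    {P : MvPolynomial (Fin (n + 1)) ℝ} (hP : P.totalDegree ≤ p) {x : E (n + 1)}
    (hx : x ∈ hull K) :
    polyVal P x ^ 2 ≤ inverseConst (n + 1) p * cornerVolume (n + 1) / volume.real (hull K)
      * ∫ z in hull K, polyVal P z ^ 2 := by
  obtain ⟨e, he, her⟩ := hK.exists_enumeration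
  obtain ⟨Q, hQ, hPQ⟩ := exists_polyVal_simplexParam e hP
  have hvol : (volume : Measure (E (n + 1))) = μHE[n + 1] :=
    (EuclideanSpace.euclideanHausdorffMeasure_eq_volume (n + 1)).symm
  have hI := setIntegral_convexHull he (fun x => polyVal P x ^ 2)
  have hV := hausdorffMeasure_convexHull e
  have himg := image_simplexParam e
  rw [her] at hI hV himg
  rw [← hvol] at hI hV
  rw [hull, ← himg] at hx
  obtain ⟨y, hy, rfl⟩ := hx
  have h := (exists_sup_le_integral (n + 1) p).choose_spec.2 Q hQ y hy
  rw [hI, hV, hPQ]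
  simp only [hPQ]
  have := cornerVolume_pos (n + 1)
  have := normDet_edgeMap_pos he
  refine h.trans (le_of_eq ?_)
  rw [inverseConst]
  field_simp

theorem cornerVolume_le_one (n : ℕ) : cornerVolume n ≤ 1 := by
  have hsub : cornerSimplex n ⊆ (WithLp.ofLp : E n → Fin n → ℝ) ⁻¹' Set.Icc 0 1 := by
    intro y hy
    exact ⟨fun j => hy.1 j, fun j =>
      (Finset.single_le_sum (fun i _ => hy.1 i) (Finset.mem_univ j)).trans hy.2⟩
  have h1 : volume ((WithLp.ofLp : E n → Fin n → ℝ) ⁻¹' Set.Icc 0 1) = 1 := by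
    rw [(PiLp.volume_preserving_ofLp (Fin n)).measure_preimage measurableSet_Icc.nullMeasurableSet,
      Real.volume_Icc_pi]
    simp
  have h2 := measure_mono (μ := volume) hsub
  rw [h1] at h2
  have := ENNReal.toReal_mono ENNReal.one_ne_top h2
  simpa [cornerVolume, Measure.real] using this

theorem hausdorffMeasure_face_lt_top {n m : ℕ} {F : Finset (E m)} (hF : F.card = n + 1) :
    (μHE[n] : Measure (E m)) (hull F) < ⊤ := by
  obtain ⟨f, -, hfr⟩ := exists_enumeration F hF
  rw [hull, ← hfr]
  exact hausdorffMeasure_convexHull_lt_top f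

theorem integrableOn_face {n : ℕ} {F : Finset (E (n + 1))} (hF : F.card = n + 1)
    {g : E (n + 1) → ℝ} (hg : Continuous g) :
    IntegrableOn g (hull F) (μHE[n] : Measure (E (n + 1))) :=
  hg.continuousOn.integrableOn_of_subset_isCompact (isCompact_hull F)
    (isCompact_hull F).measurableSet subset_rfl (hausdorffMeasure_face_lt_top hF).ne

theorem hausdorffMeasure_face_le {n : ℕ} {F K : Finset (E (n + 1))} (hF : F.card = n + 1)
    (hFK : F ⊆ K) :
    (μHE[n] : Measure (E (n + 1))).real (hull F) ≤ (n * Metric.diam (hull K)) ^ n := by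
  obtain ⟨f, -, hfr⟩ := exists_enumeration F hF
  have hmem : ∀ j, f j ∈ hull K := fun j => subset_convexHull ℝ _ (hFK (by
    rw [← Finset.mem_coe, ← hfr]; exact ⟨j, rfl⟩))
  rw [hull, ← hfr, hausdorffMeasure_convexHull]
  have h1 := normDet_edgeMap_le f (D := Metric.diam (hull K)) Metric.diam_nonneg fun j => by
    rw [← dist_eq_norm]
    exact Metric.dist_le_diam_of_mem (isCompact_hull K).isBounded (hmem _) (hmem _)
  calc _ ≤ (edgeMap f).normDet * 1 :=
        mul_le_mul_of_nonneg_left (cornerVolume_le_one n) (LinearMap.normDet_nonneg _)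
    _ ≤ _ := by rw [mul_one]; exact h1

theorem faceSize_nonneg {d : ℕ} (F : Finset (E d)) : 0 ≤ faceSize F :=
  Real.rpow_nonneg measureReal_nonneg _

/-- In dimension one the exponent in `faceSize` is `1 / 0 = 0`, so that `n = 0` is excluded. -/
theorem faceSize_pow {n : ℕ} (hn : n ≠ 0) (F : Finset (E (n + 1))) :
    faceSize F ^ n = (μHE[n] : Measure (E (n + 1))).real (hull F) := by
  have h : ((n + 1 : ℕ) : ℝ) - 1 = n := by push_cast; ring
  rw [faceSize, h, one_div]
  exact Real.rpow_inv_natCast_pow measureReal_nonneg hn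

theorem faceSize_le {n : ℕ} (hn : n ≠ 0) {F K : Finset (E (n + 1))} (hF : F.card = n + 1)
    (hFK : F ⊆ K) : faceSize F ≤ n * Metric.diam (hull K) := by
  have h := hausdorffMeasure_face_le hF hFK
  rw [← faceSize_pow hn] at h
  exact (pow_le_pow_iff_left₀ (faceSize_nonneg F)
    (mul_nonneg (Nat.cast_nonneg _) Metric.diam_nonneg) hn).1 h

/-- The volume of the unit ball. -/
noncomputable def unitBallVolume (d : ℕ) : ℝ := volume.real (Metric.ball (0 : E d) 1)

theorem unitBallVolume_pos (d : ℕ) : 0 < unitBallVolume d :=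
  ENNReal.toReal_pos (Metric.measure_ball_pos _ _ one_pos).ne'
    (measure_ball_lt_top (μ := (volume : Measure (E d)))).ne

theorem le_of_mem_inballDiam_set {n : ℕ} (K : Finset (E (n + 1))) {δ : ℝ}
    (hδ : δ ∈ {δ : ℝ | ∃ (x : E (n + 1)) (r : ℝ), 0 ≤ r ∧ Metric.closedBall x r ⊆ hull K ∧
      δ = 2 * r}) :
    δ ≤ 2 * (volume.real (hull K) / unitBallVolume (n + 1)) ^ (((n + 1 : ℕ) : ℝ)⁻¹) := by
  obtain ⟨x, r, hr, hsub, rfl⟩ := hδ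
  have h1 : volume.real (Metric.closedBall x r) = r ^ (n + 1) * unitBallVolume (n + 1) := by
    rw [Measure.addHaar_real_closedBall _ _ hr, finrank_euclideanSpace_fin, unitBallVolume]
  have h2 := measureReal_mono (μ := volume) hsub (isCompact_hull K).measure_lt_top.ne
  rw [h1, ← le_div_iff₀ (unitBallVolume_pos _)] at h2
  have h3 := Real.rpow_le_rpow (by positivity) h2
    (by positivity : (0 : ℝ) ≤ ((n + 1 : ℕ) : ℝ)⁻¹)
  rw [Real.pow_rpow_inv_natCast hr (Nat.succ_ne_zero n)] at h3
  linarith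

theorem inballDiam_pow_le {n : ℕ} (K : Finset (E (n + 1))) (hK : (hull K).Nonempty) :
    inballDiam (hull K) ^ (n + 1) * unitBallVolume (n + 1)
      ≤ 2 ^ (n + 1) * volume.real (hull K) := by
  have h0 : 0 ≤ inballDiam (hull K) := by
    apply Real.sSup_nonneg
    rintro _ ⟨x, r, hr, -, rfl⟩
    positivity
  have h1 : inballDiam (hull K)
      ≤ 2 * (volume.real (hull K) / unitBallVolume (n + 1)) ^ (((n + 1 : ℕ) : ℝ)⁻¹) := by
    obtain ⟨x, hx⟩ := hK
    refine csSup_le ⟨0, x, 0, le_rfl, by simpa using hx, by simp⟩ fun δ hδ => ?_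
    exact le_of_mem_inballDiam_set K hδ
  have hpos := unitBallVolume_pos (n + 1)
  have h2 := pow_le_pow_left₀ h0 h1 (n + 1)
  rw [mul_pow, Real.rpow_inv_natCast_pow (by positivity) (Nat.succ_ne_zero n),
    ← mul_div_assoc, le_div_iff₀ hpos] at h2
  exact h2

theorem IsCell.inballDiam_pos {n : ℕ} {K : Finset (E (n + 1))} (hK : IsCell K) :
    0 < inballDiam (hull K) := by
  obtain ⟨x, hx⟩ := hK.interior_nonempty
  obtain ⟨ε, hε, hb⟩ := Metric.isOpen_iff.1 isOpen_interior x hx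
  refine lt_of_lt_of_le (by positivity : 0 < 2 * (ε / 2)) (le_csSup ⟨_, fun δ hδ =>
    le_of_mem_inballDiam_set K hδ⟩ ⟨x, ε / 2, by positivity, ?_, rfl⟩)
  exact ((Metric.closedBall_subset_ball (by linarith)).trans hb).trans interior_subset

/-- The constant of the discrete trace inequality. -/
noncomputable def traceConst (n p : ℕ) (θ : ℝ) : ℝ :=
  (2 * (n * θ)) ^ (n + 1) / unitBallVolume (n + 1)
    * (inverseConst (n + 1) p * cornerVolume (n + 1))

theorem traceConst_nonneg (n p : ℕ) {θ : ℝ} (hθ : 0 ≤ θ) : 0 ≤ traceConst n p θ := by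
  have := unitBallVolume_pos (n + 1)
  have := inverseConst_nonneg (n + 1) p
  have := cornerVolume_pos (n + 1)
  unfold traceConst
  positivity

/-- The discrete trace inequality on a shape-regular simplex. -/
theorem IsCell.trace_inequality {n p : ℕ} (hn : n ≠ 0) {F K : Finset (E (n + 1))} (hK : IsCell K)
    (hF : F.card = n + 1) (hFK : F ⊆ K) {θ : ℝ}
    (hθ : Metric.diam (hull K) ≤ θ * inballDiam (hull K))
    {P : MvPolynomial (Fin (n + 1)) ℝ} (hP : P.totalDegree ≤ p) :
    faceSize F * ∫ x in hull F, polyVal P x ^ 2 ∂(μHE[n] : Measure (E (n + 1)))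
      ≤ traceConst n p θ * ∫ x in hull K, polyVal P x ^ 2 := by
  set I := ∫ x in hull K, polyVal P x ^ 2 with hI
  have hI0 : 0 ≤ I := integral_nonneg fun x => sq_nonneg _
  set c := inverseConst (n + 1) p * cornerVolume (n + 1) with hc
  have hc0 : 0 ≤ c := mul_nonneg (inverseConst_nonneg _ _) (cornerVolume_pos _).le
  have hV := hK.volume_pos
  have hω := unitBallVolume_pos (n + 1)
  have hρ := hK.inballDiam_pos
  have hh := faceSize_nonneg F
  have h1 : ∫ x in hull F, polyVal P x ^ 2 ∂(μHE[n] : Measure (E (n + 1)))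
      ≤ faceSize F ^ n * (c / volume.real (hull K) * I) := by
    rw [faceSize_pow hn]
    have h2 : ∫ x in hull F, polyVal P x ^ 2 ∂(μHE[n] : Measure (E (n + 1)))
        ≤ ∫ _x in hull F, c / volume.real (hull K) * I ∂(μHE[n] : Measure (E (n + 1))) := by
      refine setIntegral_mono_on (integrableOn_face hF ((polyVal_continuous P).pow 2))
        (integrableOn_face hF continuous_const) (isCompact_hull F).measurableSet fun x hx => ?_
      exact hK.sq_polyVal_le hP (convexHull_mono (by exact_mod_cast hFK) hx)
    rwa [setIntegral_const, smul_eq_mul] at h2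
  have h3 : faceSize F ^ (n + 1) ≤ (n * (θ * inballDiam (hull K))) ^ (n + 1) :=
    pow_le_pow_left₀ hh ((faceSize_le hn hF hFK).trans
      (mul_le_mul_of_nonneg_left hθ (Nat.cast_nonneg _))) _
  have h4 := inballDiam_pow_le K (hK.interior_nonempty.mono interior_subset)
  have hθ0 : 0 ≤ θ := by
    by_contra h
    have := mul_neg_of_neg_of_pos (not_le.1 h) hρ
    linarith [Metric.diam_nonneg (s := hull K)]
  have h5 : faceSize F ^ (n + 1) / volume.real (hull K)
      ≤ (2 * (n * θ)) ^ (n + 1) / unitBallVolume (n + 1) := by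
    rw [div_le_div_iff₀ hV hω]
    calc faceSize F ^ (n + 1) * unitBallVolume (n + 1)
        ≤ (n * (θ * inballDiam (hull K))) ^ (n + 1) * unitBallVolume (n + 1) :=
          mul_le_mul_of_nonneg_right h3 hω.le
      _ = (n * θ) ^ (n + 1) * (inballDiam (hull K) ^ (n + 1) * unitBallVolume (n + 1)) := by
          ring
      _ ≤ (n * θ) ^ (n + 1) * (2 ^ (n + 1) * volume.real (hull K)) :=
          mul_le_mul_of_nonneg_left h4 (by positivity)
      _ = (2 * (n * θ)) ^ (n + 1) * volume.real (hull K) := by rw [mul_pow 2]; ring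
  calc faceSize F * ∫ x in hull F, polyVal P x ^ 2 ∂(μHE[n] : Measure (E (n + 1)))
      ≤ faceSize F * (faceSize F ^ n * (c / volume.real (hull K) * I)) :=
        mul_le_mul_of_nonneg_left h1 hh
    _ = faceSize F ^ (n + 1) / volume.real (hull K) * (c * I) := by ring
    _ ≤ (2 * (n * θ)) ^ (n + 1) / unitBallVolume (n + 1) * (c * I) :=
        mul_le_mul_of_nonneg_right h5 (mul_nonneg hc0 hI0)
    _ = traceConst n p θ * I := by rw [traceConst, ← hc]; ring

/-! ### Geometry of the mesh -/

theorem volume_hull_eq_zero {n : ℕ} {s : Finset (E (n + 1))} (hs : s.card < n + 2) :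
    volume (hull s) = 0 := by
  rcases s.eq_empty_or_nonempty with rfl | hne
  · simp [hull]
  refine measure_mono_null (convexHull_subset_affineSpan _)
    (Measure.addHaar_affineSubspace _ _ fun htop => ?_)
  have h1 : vectorSpan ℝ (s : Set (E (n + 1))) = ⊤ := by
    rw [← direction_affineSpan, htop, AffineSubspace.direction_top]
  classical
  obtain ⟨k, hk⟩ : ∃ k, s.card = k + 1 := ⟨s.card - 1, by have := hne.card_pos; omega⟩
  have h2 := finrank_vectorSpan_image_finset_le ℝ id s hk
  rw [Finset.image_id, h1, finrank_top, finrank_euclideanSpace_fin] at h2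
  omega

theorem abs_mul_setAverage_le {X : Type*} [MeasurableSpace X] {μ : Measure X} {s : Set X}
    {f : X → ℝ} {φ : ℝ} (hφ : |φ| ≤ μ.real s) :
    |φ * ⨍ x in s, f x ∂μ| ≤ ∫ x in s, |f x| ∂μ := by
  rw [setAverage_eq, smul_eq_mul, abs_mul, abs_mul, ← mul_assoc]
  have h0 : 0 ≤ μ.real s := measureReal_nonneg
  have h1 : |φ| * |(μ.real s)⁻¹| ≤ 1 := by
    rw [abs_of_nonneg (inv_nonneg.2 h0)]
    exact (mul_le_mul_of_nonneg_right hφ (inv_nonneg.2 h0)).trans mul_inv_le_one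
  calc |φ| * |(μ.real s)⁻¹| * |∫ x in s, f x ∂μ| ≤ 1 * |∫ x in s, f x ∂μ| :=
        mul_le_mul_of_nonneg_right h1 (abs_nonneg _)
    _ ≤ ∫ x in s, |f x| ∂μ := by rw [one_mul]; exact abs_integral_le_integral_abs

namespace Mesh

variable {n : ℕ} {Ω : Set (E (n + 1))} (T : Mesh Ω)

theorem mem_cells {K : Finset (E (n + 1))} : K ∈ T.cells ↔ K ∈ T.faces ∧ K.card = n + 2 := by
  classical
  simp [cells]

theorem mem_facets {F : Finset (E (n + 1))} : F ∈ T.facets ↔ F ∈ T.faces ∧ F.card = n + 1 := by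
  classical
  simp [facets]

theorem mem_adjacentCells {F K : Finset (E (n + 1))} :
    K ∈ T.adjacentCells F ↔ K ∈ T.cells ∧ F ⊆ K := by
  classical
  simp [adjacentCells]

variable {T}

theorem isCell {K : Finset (E (n + 1))} (hK : K ∈ T.cells) : IsCell K :=
  ⟨T.indep ((T.mem_cells).1 hK).1, ((T.mem_cells).1 hK).2⟩

theorem volume_inter_eq_zero {K K' : Finset (E (n + 1))} (hK : K ∈ T.cells) (hK' : K' ∈ T.cells)
    (hne : K ≠ K') : volume (hull K ∩ hull K') = 0 := by
  classical
  have h1 := T.inter_subset_convexHull ((T.mem_cells).1 hK).1 ((T.mem_cells).1 hK').1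
  have h2 : (K ∩ K').card < n + 2 := by
    rw [← (isCell hK).card]
    refine Finset.card_lt_card (Finset.ssubset_iff_subset_ne.2 ⟨Finset.inter_subset_left,
      fun h => hne ?_⟩)
    exact Finset.eq_of_subset_of_card_le (Finset.inter_eq_left.1 h)
      (by rw [(isCell hK).card, (isCell hK').card])
  refine measure_mono_null h1 ?_
  have := volume_hull_eq_zero h2
  rwa [hull, Finset.coe_inter] at this

theorem exists_eq_insert {F K : Finset (E (n + 1))} [DecidableEq (E (n + 1))]
    (hF : F.card = n + 1) (hK : IsCell K) (hFK : F ⊆ K) : ∃ a ∉ F, K = insert a F := by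
  have h1 : (K \ F).card = 1 := by
    rw [Finset.card_sdiff_of_subset hFK, hK.card, hF]
    omega
  obtain ⟨a, ha⟩ := Finset.card_eq_one.1 h1
  have haK : a ∈ K \ F := by rw [ha]; exact Finset.mem_singleton_self a
  refine ⟨a, (Finset.mem_sdiff.1 haK).2, ?_⟩
  rw [← Finset.sdiff_union_of_subset hFK, ha, Finset.insert_eq]

/-- Two cells of a mesh that share a face lie on opposite sides of it. -/
theorem cells_opposite [DecidableEq (E (n + 1))] {F : Finset (E (n + 1))} {a b : E (n + 1)}
    (ha : a ∉ F) (hb : b ∉ F)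
    (hab : a ≠ b) (hKa : insert a F ∈ T.cells) (hKb : insert b F ∈ T.cells)
    (ℓ ℓ' : E (n + 1) →ₗ[ℝ] ℝ) (hℓ : ∀ f ∈ F, ℓ (a - f) = 1) (hℓ' : ∀ f ∈ F, ℓ' (b - f) = 1) :
    ∀ f ∈ F, ℓ (b - f) < 0 := by
  refine opposite_sides ha hb (by convert isCell hKa) ?_ ℓ ℓ' hℓ hℓ'
  have h1 := T.inter_subset_convexHull ((T.mem_cells).1 hKa).1 ((T.mem_cells).1 hKb).1
  have h2 : ((insert a F : Finset _) : Set (E (n + 1))) ∩ ((insert b F : Finset _) : Set _)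
      = F := by
    rw [← Finset.coe_inter]
    congr 1
    ext x
    simp only [Finset.mem_inter, Finset.mem_insert]
    constructor
    · rintro ⟨rfl | h, rfl | h'⟩
      · exact absurd rfl hab
      · exact h'
      · exact h
      · exact h
    · exact fun h => ⟨Or.inr h, Or.inr h⟩
  rw [h2] at h1
  exact h1

theorem exists_barycentric_grad [DecidableEq (E (n + 1))] {F : Finset (E (n + 1))}
    {a : E (n + 1)} (ha : a ∉ F) (hK : IsCell (insert a F)) :
    ∃ ℓ : E (n + 1) →ₗ[ℝ] ℝ, ∀ f ∈ F, ℓ (a - f) = 1 := by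
  obtain ⟨c, hc, -⟩ := hK.setIntegral_pderiv 0
  obtain ⟨ℓ, hℓ, -⟩ := hc a (Finset.mem_insert_self a F)
  rw [Finset.erase_insert ha] at hℓ
  exact ⟨ℓ, hℓ⟩

/-- At most two cells share a face, because the normals of three of them would cancel pairwise. -/
theorem adjacentCells_eq_pair [DecidableEq (E (n + 1))] {F K K' : Finset (E (n + 1))}
    (hF : F ∈ T.facets) (hK : K ∈ T.cells)
    (hK' : K' ∈ T.cells) (hne : K ≠ K') (hFK : F ⊆ K) (hFK' : F ⊆ K') :
    T.adjacentCells F = {K, K'} := by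
  ext L
  rw [mem_adjacentCells, Finset.mem_insert, Finset.mem_singleton]
  constructor
  swap
  · rintro (rfl | rfl)
    exacts [⟨hK, hFK⟩, ⟨hK', hFK'⟩]
  rintro ⟨hL, hFL⟩
  by_contra! hcon
  have hFc := ((T.mem_facets).1 hF).2
  obtain ⟨a, ha, rfl⟩ := exists_eq_insert hFc (isCell hK) hFK
  obtain ⟨b, hb, rfl⟩ := exists_eq_insert hFc (isCell hK') hFK'
  obtain ⟨c, hc, rfl⟩ := exists_eq_insert hFc (isCell hL) hFL
  have hab : a ≠ b := fun h => hne (by rw [h])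
  have hac : a ≠ c := fun h => hcon.1 (by rw [h])
  have hbc : b ≠ c := fun h => hcon.2 (by rw [h])
  obtain ⟨ℓa, hℓa⟩ := exists_barycentric_grad ha (isCell hK)
  obtain ⟨ℓb, hℓb⟩ := exists_barycentric_grad hb (isCell hK')
  obtain ⟨ℓc, hℓc⟩ := exists_barycentric_grad hc (isCell hL)
  have hKa : IsCell (insert a F) := isCell hK
  have hKb : IsCell (insert b F) := isCell hK'
  have hKc : IsCell (insert c F) := isCell hL
  have h1 := cells_opposite ha hb hab hK hK' ℓa ℓb hℓa hℓb
  have h2 := cells_opposite ha hc hac hK hL ℓa ℓc hℓa hℓc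
  have h3 := cells_opposite hb hc hbc hK' hL ℓb ℓc hℓb hℓc
  have hzero : ∀ i, ℓa (EuclideanSpace.single i 1) = 0 := by
    intro i
    have e1 := flux_antisymm hFc ha hb (hKa) (hKb) ℓa ℓb hℓa hℓb h1 i
    have e2 := flux_antisymm hFc ha hc (hKa) (hKc) ℓa ℓc hℓa hℓc h2 i
    have e3 := flux_antisymm hFc hb hc (hKb) (hKc) ℓb ℓc hℓb hℓc h3 i
    have hpos := mul_pos hKa.volume_pos (cornerRatio_pos n)
    have e4 : volume.real (hull (insert a F)) * cornerRatio n * ℓa (EuclideanSpace.single i 1)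
        = 0 := by
      linarith
    exact (mul_eq_zero.1 e4).resolve_left hpos.ne'
  obtain ⟨f, hf⟩ : F.Nonempty := Finset.card_pos.1 (by omega)
  have hx : a - f = ∑ r, (a - f) r • (EuclideanSpace.single r 1 : E (n + 1)) := by
    ext s
    simp [Pi.single_apply]
  have := hℓa f hf
  rw [hx, map_sum, Finset.sum_eq_zero] at this
  · exact zero_ne_one this
  · intro r _
    rw [map_smul, hzero, smul_zero]

theorem jump_of_interior {V : Type*} [AddCommGroup V] {F : Finset (E (n + 1))}
    (h : ∃ K K', K ∈ T.cells ∧ K' ∈ T.cells ∧ K ≠ K' ∧ F ⊆ K ∧ F ⊆ K') :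
    ∃ K K', K ∈ T.cells ∧ K' ∈ T.cells ∧ K ≠ K' ∧ F ⊆ K ∧ F ⊆ K' ∧
      ∀ w : Finset (E (n + 1)) → V, T.jump w F = w K - w K' := by
  obtain ⟨h1, h2, h3, h4, h5⟩ := h.choose_spec.choose_spec
  exact ⟨h.choose, h.choose_spec.choose, h1, h2, h3, h4, h5, fun w => by rw [jump, dif_pos h]⟩

theorem jump_of_boundary {V : Type*} [AddCommGroup V] {F : Finset (E (n + 1))}
    (h : ¬ ∃ K K', K ∈ T.cells ∧ K' ∈ T.cells ∧ K ≠ K' ∧ F ⊆ K ∧ F ⊆ K')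
    (w : Finset (E (n + 1)) → V) : T.jump w F = ∑ K ∈ T.adjacentCells F, w K := by
  rw [jump, dif_neg h]

/-- A face that is not shared by two cells is in at most one. That it is in one is not needed: the
jump across a face outside all cells is an empty sum. -/
theorem adjacentCells_boundary {F : Finset (E (n + 1))}
    (h : ¬ ∃ K K', K ∈ T.cells ∧ K' ∈ T.cells ∧ K ≠ K' ∧ F ⊆ K ∧ F ⊆ K') :
    T.adjacentCells F = ∅ ∨ ∃ K, T.adjacentCells F = {K} := by
  rcases (T.adjacentCells F).eq_empty_or_nonempty with h0 | ⟨K, hK⟩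
  · exact Or.inl h0
  · refine Or.inr ⟨K, Finset.eq_singleton_iff_unique_mem.2 ⟨hK, fun L hL => ?_⟩⟩
    rw [mem_adjacentCells] at hK hL
    by_contra hne
    exact h ⟨L, K, hL.1, hK.1, hne, hL.2, hK.2⟩

/-- The sum of the integrals of a derivative over the cells is controlled by the jumps across the
faces: the elementwise divergence theorem, in which the normals of the two cells that share an
interior face cancel. -/
theorem abs_sum_integral_pderiv_le (g : Finset (E (n + 1)) → MvPolynomial (Fin (n + 1)) ℝ)
    (i : Fin (n + 1)) :
    |∑ K ∈ T.cells, ∫ x in hull K, polyVal (MvPolynomial.pderiv i (g K)) x|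
      ≤ ∑ F ∈ T.facets, ∫ x in hull F, |T.jump (fun K => polyVal (g K) x) F|
          ∂(μHE[n] : Measure (E (n + 1))) := by
  classical
  have hex : ∀ K : Finset (E (n + 1)), ∃ c : E (n + 1) → ℝ, K ∈ T.cells →
      (∀ a ∈ K, ∃ ℓ : E (n + 1) →ₗ[ℝ] ℝ, (∀ f ∈ K.erase a, ℓ (a - f) = 1) ∧
        c a = -(volume.real (hull K) * cornerRatio n * ℓ (EuclideanSpace.single i 1))) ∧
      ∀ Q : MvPolynomial (Fin (n + 1)) ℝ,
        ∫ x in hull K, polyVal (MvPolynomial.pderiv i Q) x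
          = ∑ a ∈ K, c a *
              ⨍ x in hull (K.erase a), polyVal Q x ∂(μHE[n] : Measure (E (n + 1))) := by
    intro K
    by_cases hK : K ∈ T.cells
    · obtain ⟨c, hc⟩ := (isCell hK).setIntegral_pderiv i
      exact ⟨c, fun _ => hc⟩
    · exact ⟨0, fun h => absurd h hK⟩
  choose c hc using hex
  set φ : Finset (E (n + 1)) → Finset (E (n + 1)) → ℝ := fun K F => ∑ a ∈ K \ F, c K a with hφ
  set A : Finset (E (n + 1)) → Finset (E (n + 1)) → ℝ := fun K F =>
    ⨍ x in hull F, polyVal (g K) x ∂(μHE[n] : Measure (E (n + 1))) with hA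
  have hφi : ∀ (F : Finset (E (n + 1))) (a : E (n + 1)), a ∉ F →
      φ (insert a F) F = c (insert a F) a := by
    intro F a ha
    have : insert a F \ F = {a} := by
      ext x
      simp only [Finset.mem_sdiff, Finset.mem_insert, Finset.mem_singleton]
      constructor
      · rintro ⟨h | h, h'⟩
        exacts [h, absurd h h']
      · rintro rfl
        exact ⟨Or.inl rfl, ha⟩
    simp only [hφ]
    rw [this, Finset.sum_singleton]
  have hgrad : ∀ (F : Finset (E (n + 1))) (a : E (n + 1)), a ∉ F → insert a F ∈ T.cells →
      ∃ ℓ : E (n + 1) →ₗ[ℝ] ℝ, (∀ f ∈ F, ℓ (a - f) = 1) ∧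
        φ (insert a F) F = -(volume.real (hull (insert a F)) * cornerRatio n
          * ℓ (EuclideanSpace.single i 1)) := by
    intro F a ha hK
    obtain ⟨ℓ, h1, h2⟩ := (hc _ hK).1 a (Finset.mem_insert_self a F)
    rw [Finset.erase_insert ha] at h1
    exact ⟨ℓ, h1, by rw [hφi F a ha, h2]⟩
  have hφle : ∀ F ∈ T.facets, ∀ K ∈ T.adjacentCells F,
      |φ K F| ≤ (μHE[n] : Measure (E (n + 1))).real (hull F) := by
    intro F hF K hK
    obtain ⟨hK, hFK⟩ := (T.mem_adjacentCells).1 hK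
    have hFc := ((T.mem_facets).1 hF).2
    obtain ⟨a, ha, rfl⟩ := exists_eq_insert hFc (isCell hK) hFK
    obtain ⟨ℓ, h1, h2⟩ := hgrad F a ha hK
    rw [h2, abs_neg]
    exact abs_flux_le hFc ha (isCell hK) ℓ h1 i
  have hcell : ∀ K ∈ T.cells, ∫ x in hull K, polyVal (MvPolynomial.pderiv i (g K)) x
      = ∑ F ∈ T.facets with F ⊆ K, φ K F * A K F := by
    intro K hK
    rw [(hc K hK).2 (g K)]
    refine Finset.sum_bij (fun a _ => K.erase a) ?_ ?_ ?_ ?_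
    · intro a ha
      have hcard : (K.erase a).card = n + 1 := by
        rw [Finset.card_erase_of_mem ha, (isCell hK).card]
        rfl
      rw [Finset.mem_filter, mem_facets]
      exact ⟨⟨T.down_closed ((T.mem_cells).1 hK).1 (Finset.erase_subset a K)
        (Finset.card_pos.1 (by omega)), hcard⟩, Finset.erase_subset a K⟩
    · intro a ha b hb hab
      by_contra hne
      have : a ∈ K.erase b := Finset.mem_erase.2 ⟨hne, ha⟩
      rw [← hab] at this
      exact Finset.notMem_erase a K this
    · intro F hF
      rw [Finset.mem_filter, mem_facets] at hF
      obtain ⟨a, ha, rfl⟩ := exists_eq_insert hF.1.2 (isCell hK) hF.2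
      exact ⟨a, Finset.mem_insert_self a F, Finset.erase_insert ha⟩
    · intro a ha
      have h1 := hφi (K.erase a) a (Finset.notMem_erase a K)
      rw [Finset.insert_erase ha] at h1
      rw [h1]
  have hswap : ∑ K ∈ T.cells, ∫ x in hull K, polyVal (MvPolynomial.pderiv i (g K)) x
      = ∑ F ∈ T.facets, ∑ K ∈ T.adjacentCells F, φ K F * A K F := by
    rw [Finset.sum_congr rfl hcell]
    refine Finset.sum_comm' fun K F => ?_
    rw [Finset.mem_filter, mem_adjacentCells]
    tauto
  rw [hswap]
  refine (Finset.abs_sum_le_sum_abs _ _).trans (Finset.sum_le_sum fun F hF => ?_)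
  have hFc := ((T.mem_facets).1 hF).2
  by_cases h : ∃ K K', K ∈ T.cells ∧ K' ∈ T.cells ∧ K ≠ K' ∧ F ⊆ K ∧ F ⊆ K'
  · obtain ⟨K, K', hK, hK', hne, hFK, hFK', hjump⟩ := jump_of_interior (V := ℝ) h
    have hadj := adjacentCells_eq_pair hF hK hK' hne hFK hFK'
    have hle := hφle F hF K (by rw [hadj]; exact Finset.mem_insert_self _ _)
    simp only [hjump]
    rw [hadj, Finset.sum_pair hne]
    have hanti : φ K' F = -φ K F := by
      obtain ⟨a, ha, rfl⟩ := exists_eq_insert hFc (isCell hK) hFK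
      obtain ⟨b, hb, rfl⟩ := exists_eq_insert hFc (isCell hK') hFK'
      have hab : a ≠ b := fun h => hne (by rw [h])
      obtain ⟨ℓa, h1, h2⟩ := hgrad F a ha hK
      obtain ⟨ℓb, h3, h4⟩ := hgrad F b hb hK'
      have h5 := cells_opposite ha hb hab hK hK' ℓa ℓb h1 h3
      have h6 := flux_antisymm hFc ha hb (isCell hK) (isCell hK')
        ℓa ℓb h1 h3 h5 i
      rw [h2, h4, h6, neg_neg]
    have hsub : A K F - A K' F
        = ⨍ x in hull F, (polyVal (g K) x - polyVal (g K') x)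
            ∂(μHE[n] : Measure (E (n + 1))) := by
      simp only [hA, setAverage_eq]
      rw [integral_sub (integrableOn_face hFc (polyVal_continuous _))
        (integrableOn_face hFc (polyVal_continuous _)), smul_sub]
    rw [hanti, neg_mul, ← sub_eq_add_neg, ← mul_sub, hsub]
    exact abs_mul_setAverage_le hle
  · simp only [jump_of_boundary h]
    rcases adjacentCells_boundary h with h0 | ⟨K, hadj⟩
    · simp [h0]
    · have hle := hφle F hF K (by rw [hadj]; exact Finset.mem_singleton_self _)
      simp only [hadj, Finset.sum_singleton]
      exact abs_mul_setAverage_le hle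

end Mesh

/-! ### Piecewise polynomials, integrals over the domain -/

theorem totalDegree_pderiv_le {σ : Type*} (i : σ) (P : MvPolynomial σ ℝ) :
    (MvPolynomial.pderiv i P).totalDegree ≤ P.totalDegree := by
  classical
  have h : MvPolynomial.pderiv i P = ∑ s ∈ P.support,
      MvPolynomial.monomial (s - Finsupp.single i 1) (P.coeff s * s i) := by
    conv_lhs => rw [← MvPolynomial.support_sum_monomial_coeff P]
    rw [map_sum]
    exact Finset.sum_congr rfl fun s _ => MvPolynomial.pderiv_monomial
  rw [h]
  refine MvPolynomial.totalDegree_finsetSum_le fun s hs => ?_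
  refine (MvPolynomial.totalDegree_monomial_le _ _).trans
    (le_trans ?_ (MvPolynomial.le_totalDegree hs))
  have hle : s - Finsupp.single i 1 ≤ s := tsub_le_self
  rw [Finsupp.sum_of_support_subset _ (Finsupp.support_mono hle) _ (by simp)]
  exact Finset.sum_le_sum fun j _ => hle j

theorem closure_ae_eq_of_convex {d : ℕ} {Ω : Set (E d)} (h : Convex ℝ Ω) :
    closure Ω =ᵐ[volume] Ω := by
  refine ae_eq_set.2 ⟨?_, ?_⟩
  · refine measure_mono_null (fun x hx => ?_) (h.addHaar_frontier volume)
    exact ⟨hx.1, fun hxi => hx.2 (interior_subset hxi)⟩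
  · rw [Set.sdiff_eq_empty.2 subset_closure, measure_empty]

theorem polyVal_add {d : ℕ} (P Q : MvPolynomial (Fin d) ℝ) (x : E d) :
    polyVal (P + Q) x = polyVal P x + polyVal Q x := map_add _ P Q

theorem polyVal_mul {d : ℕ} (P Q : MvPolynomial (Fin d) ℝ) (x : E d) :
    polyVal (P * Q) x = polyVal P x * polyVal Q x := map_mul _ P Q

theorem integrableOn_hull {d : ℕ} (K : Finset (E d)) {g : E d → ℝ} (hg : Continuous g) :
    IntegrableOn g (hull K) :=
  hg.continuousOn.integrableOn_compact (isCompact_hull K)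

namespace Mesh

variable {n : ℕ} {Ω : Set (E (n + 1))} {T : Mesh Ω}

theorem cells_subset_closure {K : Finset (E (n + 1))} (hK : K ∈ T.cells) :
    hull K ⊆ closure Ω := by
  rw [← T.space_eq]
  exact T.convexHull_subset_space ((T.mem_cells).1 hK).1

/-- The faces of lower dimension are null sets, so the cells exhaust the domain. -/
theorem iUnion_cells_ae_eq (hΩ : Convex ℝ Ω) :
    (⋃ K : T.cells, hull K.1) =ᵐ[volume] Ω := by
  refine EventuallyEq.trans ?_ (closure_ae_eq_of_convex hΩ)
  refine ae_eq_set.2 ⟨?_, ?_⟩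
  · rw [Set.sdiff_eq_empty.2 (Set.iUnion_subset fun K => cells_subset_closure K.2), measure_empty]
  · have hsub : closure Ω \ (⋃ K : T.cells, hull K.1)
        ⊆ ⋃ s ∈ {s ∈ T.faces | s.card < n + 2}, hull s := by
      rintro x ⟨hx, hxn⟩
      rw [← T.space_eq] at hx
      obtain ⟨s, hs, hxs⟩ := (T.mem_space_iff).1 hx
      refine Set.mem_biUnion (x := s) ⟨hs, ?_⟩ hxs
      have h1 : s.card ≤ n + 2 := by
        have := (T.indep hs).card_le_finrank_succ
        rw [Fintype.card_coe] at this
        refine this.trans (Nat.succ_le_succ ?_)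
        exact (Submodule.finrank_le _).trans (by rw [finrank_euclideanSpace_fin])
      refine lt_of_le_of_ne h1 fun h2 => hxn ?_
      exact Set.mem_iUnion.2 ⟨⟨s, (T.mem_cells).2 ⟨hs, h2⟩⟩, hxs⟩
    refine measure_mono_null hsub ((measure_biUnion_null_iff
      (T.finite_faces.subset (Set.sep_subset _ _)).countable).2 fun s hs => ?_)
    exact volume_hull_eq_zero hs.2

theorem setIntegral_eq_sum (hΩ : Convex ℝ Ω) {f : E (n + 1) → ℝ}
    {g : Finset (E (n + 1)) → E (n + 1) → ℝ} (hg : ∀ K, Continuous (g K))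
    (hfg : ∀ K ∈ T.cells, f =ᵐ[volume.restrict (hull K)] g K) :
    ∫ x in Ω, f x = ∑ K ∈ T.cells, ∫ x in hull K, g K x := by
  rw [← setIntegral_congr_set (iUnion_cells_ae_eq (T := T) hΩ), integral_iUnion_ae, tsum_fintype,
    ← Finset.sum_coe_sort T.cells]
  · exact Finset.sum_congr rfl fun K _ => integral_congr_ae (hfg K.1 K.2)
  · exact fun K => (isCompact_hull K.1).measurableSet.nullMeasurableSet
  · intro K K' hne
    exact volume_inter_eq_zero K.2 K'.2 fun h => hne (Subtype.ext h)
  · exact integrableOn_finite_iUnion.2 fun K =>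
      (integrableOn_hull K.1 (hg K.1)).congr (hfg K.1 K.2).symm

theorem piecewise_ae_eq {V : Type*} [AddCommMonoid V]
    (w : Finset (E (n + 1)) → E (n + 1) → V) {K : Finset (E (n + 1))} (hK : K ∈ T.cells) :
    ∀ᵐ x ∂(volume.restrict (hull K)), T.piecewise w x = w K x := by
  have hfr : volume (frontier (hull K)) = 0 := (convex_convexHull ℝ _).addHaar_frontier volume
  have h1 : ∀ᵐ x ∂(volume.restrict (hull K)), x ∉ frontier (hull K) :=
    ae_restrict_of_ae (measure_eq_zero_iff_ae_notMem.1 hfr)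
  filter_upwards [h1, ae_restrict_mem (isCompact_hull K).measurableSet] with x hx hxK
  have hxi : x ∈ interior (hull K) := by
    by_contra h
    exact hx ⟨subset_closure hxK, h⟩
  rw [piecewise, Finset.sum_eq_single K]
  · exact Set.indicator_of_mem hxi _
  · intro K' hK' hne
    refine Set.indicator_of_notMem (fun hxi' => ?_) _
    have h2 := volume_inter_eq_zero hK hK' hne.symm
    have h3 : 0 < volume (interior (hull K) ∩ interior (hull K')) :=
      (isOpen_interior.inter isOpen_interior).measure_pos _ ⟨x, hxi, hxi'⟩
    exact h3.ne' (measure_mono_null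
      (Set.inter_subset_inter interior_subset interior_subset) h2)
  · exact fun h => absurd hK h

/-! ### Traces and jumps on the faces -/

theorem faceSize_pos {F : Finset (E (n + 1))} (hn : n ≠ 0) (hF : F ∈ T.facets) :
    0 < faceSize F := by
  obtain ⟨hFf, hFc⟩ := (T.mem_facets).1 hF
  obtain ⟨f, hfi, hfr⟩ := exists_enumeration F hFc
  have hind : AffineIndependent ℝ f := affineIndependent_of_injective (T.indep hFf) hfi
    fun j => by rw [← Finset.mem_coe, ← hfr]; exact ⟨j, rfl⟩
  have h1 : 0 < (μHE[n] : Measure (E (n + 1))).real (hull F) := by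
    rw [hull, ← hfr, hausdorffMeasure_convexHull]
    exact mul_pos (normDet_edgeMap_pos hind) (cornerVolume_pos n)
  refine lt_of_le_of_ne (faceSize_nonneg F) fun h => ?_
  rw [← faceSize_pow hn, ← h, zero_pow hn] at h1
  exact lt_irrefl _ h1

variable (T)

/-- The sum of the absolute values of the traces of `q` from the cells that contain `F`. -/
noncomputable def traceSum (q : Finset (E (n + 1)) → MvPolynomial (Fin (n + 1)) ℝ)
    (F : Finset (E (n + 1))) (x : E (n + 1)) : ℝ :=
  ∑ K ∈ T.adjacentCells F, |polyVal (q K) x|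

/-- The jump of a piecewise polynomial function. -/
noncomputable def polyJump (q : Finset (E (n + 1)) → MvPolynomial (Fin (n + 1)) ℝ)
    (F : Finset (E (n + 1))) (x : E (n + 1)) : ℝ :=
  T.jump (fun K => polyVal (q K) x) F

/-- The square of the `L²` norm of a piecewise polynomial function. -/
noncomputable def cellNormSq (q : Finset (E (n + 1)) → MvPolynomial (Fin (n + 1)) ℝ) : ℝ :=
  ∑ K ∈ T.cells, ∫ x in hull K, polyVal (q K) x ^ 2

/-- The square of the `L²` norm on `F` of the jump of a piecewise polynomial function. -/
noncomputable def jumpNormSq (q : Finset (E (n + 1)) → MvPolynomial (Fin (n + 1)) ℝ)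
    (F : Finset (E (n + 1))) : ℝ :=
  ∫ x in hull F, T.polyJump q F x ^ 2 ∂(μHE[n] : Measure (E (n + 1)))

variable {T}

theorem cellNormSq_nonneg (q : Finset (E (n + 1)) → MvPolynomial (Fin (n + 1)) ℝ) :
    0 ≤ T.cellNormSq q :=
  Finset.sum_nonneg fun _ _ => integral_nonneg fun _ => sq_nonneg _

theorem jumpNormSq_nonneg (q : Finset (E (n + 1)) → MvPolynomial (Fin (n + 1)) ℝ)
    (F : Finset (E (n + 1))) : 0 ≤ T.jumpNormSq q F :=
  integral_nonneg fun _ => sq_nonneg _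

theorem continuous_traceSum (q : Finset (E (n + 1)) → MvPolynomial (Fin (n + 1)) ℝ)
    (F : Finset (E (n + 1))) : Continuous (T.traceSum q F) :=
  continuous_finsetSum _ fun _ _ => (polyVal_continuous _).abs

theorem continuous_polyJump (q : Finset (E (n + 1)) → MvPolynomial (Fin (n + 1)) ℝ)
    (F : Finset (E (n + 1))) : Continuous (T.polyJump q F) := by
  by_cases h : ∃ K K', K ∈ T.cells ∧ K' ∈ T.cells ∧ K ≠ K' ∧ F ⊆ K ∧ F ⊆ K'
  · obtain ⟨K, K', -, -, -, -, -, hj⟩ := jump_of_interior (V := ℝ) h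
    have : T.polyJump q F = fun x => polyVal (q K) x - polyVal (q K') x :=
      funext fun x => hj _
    rw [this]
    exact (polyVal_continuous _).sub (polyVal_continuous _)
  · have : T.polyJump q F = fun x => ∑ K ∈ T.adjacentCells F, polyVal (q K) x :=
      funext fun x => jump_of_boundary h _
    rw [this]
    exact continuous_finsetSum _ fun _ _ => polyVal_continuous _

theorem mem_interiorFacets {F : Finset (E (n + 1))} (hF : F ∈ T.facets) :
    F ∈ T.interiorFacets ↔
      ∃ K K', K ∈ T.cells ∧ K' ∈ T.cells ∧ K ≠ K' ∧ F ⊆ K ∧ F ⊆ K' := by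
  classical
  rw [interiorFacets, Finset.mem_filter]
  constructor
  · rintro ⟨-, K, hK, K', hK', h1, h2, h3⟩
    exact ⟨K, K', hK, hK', h1, h2, h3⟩
  · rintro ⟨K, K', hK, hK', h1, h2, h3⟩
    exact ⟨hF, K, hK, K', hK', h1, h2, h3⟩

theorem card_adjacentCells_le {F : Finset (E (n + 1))} (hF : F ∈ T.facets) :
    (T.adjacentCells F).card ≤ 2 := by
  classical
  by_cases h : ∃ K K', K ∈ T.cells ∧ K' ∈ T.cells ∧ K ≠ K' ∧ F ⊆ K ∧ F ⊆ K'
  · obtain ⟨K, K', h1, h2, h3, h4, h5⟩ := h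
    rw [adjacentCells_eq_pair hF h1 h2 h3 h4 h5]
    exact Finset.card_le_two
  · rcases adjacentCells_boundary h with h0 | ⟨K, h0⟩ <;> simp [h0]

open Classical in
/-- The product rule for jumps; on boundary faces the jump of the first factor suffices. -/
theorem abs_polyJump_mul_le (u w : Finset (E (n + 1)) → MvPolynomial (Fin (n + 1)) ℝ)
    {F : Finset (E (n + 1))} (hF : F ∈ T.facets) (x : E (n + 1)) :
    |T.polyJump (fun K => u K * w K) F x|
      ≤ |T.polyJump u F x| * T.traceSum w F x
        + if F ∈ T.interiorFacets then T.traceSum u F x * |T.polyJump w F x| else 0 := by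
  by_cases h : ∃ K K', K ∈ T.cells ∧ K' ∈ T.cells ∧ K ≠ K' ∧ F ⊆ K ∧ F ⊆ K'
  · rw [if_pos ((mem_interiorFacets hF).2 h)]
    obtain ⟨K, K', hK, hK', hne, hFK, hFK', hj⟩ := jump_of_interior (V := ℝ) h
    simp only [polyJump, hj, traceSum, adjacentCells_eq_pair hF hK hK' hne hFK hFK',
      Finset.sum_pair hne, polyVal_mul]
    have h1 : polyVal (u K) x * polyVal (w K) x - polyVal (u K') x * polyVal (w K') x
        = (polyVal (u K) x - polyVal (u K') x) * polyVal (w K) x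
          + polyVal (u K') x * (polyVal (w K) x - polyVal (w K') x) := by ring
    rw [h1]
    refine (abs_add_le _ _).trans ?_
    rw [abs_mul, abs_mul]
    refine add_le_add (mul_le_mul_of_nonneg_left ?_ (abs_nonneg _))
      (mul_le_mul_of_nonneg_right ?_ (abs_nonneg _))
    · linarith [abs_nonneg (polyVal (w K') x)]
    · linarith [abs_nonneg (polyVal (u K) x)]
  · rw [if_neg (fun h' => h ((mem_interiorFacets hF).1 h')), add_zero]
    simp only [polyJump, jump_of_boundary h, traceSum]
    rcases adjacentCells_boundary h with h0 | ⟨K, h0⟩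
    · simp [h0]
    · simp [h0, polyVal_mul, abs_mul]

theorem abs_polyJump_sq_mul_le (u : Finset (E (n + 1)) → MvPolynomial (Fin (n + 1)) ℝ)
    (η : MvPolynomial (Fin (n + 1)) ℝ) {F : Finset (E (n + 1))} (hF : F ∈ T.facets)
    (x : E (n + 1)) :
    |T.polyJump (fun K => u K * u K * η) F x|
      ≤ |polyVal η x| * (|T.polyJump u F x| * T.traceSum u F x) := by
  classical
  by_cases h : ∃ K K', K ∈ T.cells ∧ K' ∈ T.cells ∧ K ≠ K' ∧ F ⊆ K ∧ F ⊆ K'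
  · obtain ⟨K, K', hK, hK', hne, hFK, hFK', hj⟩ := jump_of_interior (V := ℝ) h
    simp only [polyJump, hj, traceSum, adjacentCells_eq_pair hF hK hK' hne hFK hFK',
      Finset.sum_pair hne, polyVal_mul]
    have h1 : polyVal (u K) x * polyVal (u K) x * polyVal η x
          - polyVal (u K') x * polyVal (u K') x * polyVal η x
        = polyVal η x * ((polyVal (u K) x - polyVal (u K') x)
          * (polyVal (u K) x + polyVal (u K') x)) := by ring
    rw [h1, abs_mul, abs_mul]
    exact mul_le_mul_of_nonneg_left (mul_le_mul_of_nonneg_left (abs_add_le _ _) (abs_nonneg _))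
      (abs_nonneg _)
  · simp only [polyJump, jump_of_boundary h, traceSum]
    rcases adjacentCells_boundary h with h0 | ⟨K, h0⟩
    · simp [h0]
    · simp only [h0, Finset.sum_singleton, polyVal_mul, abs_mul]
      rw [mul_comm]

/-- The constant in the bound of the traces on all faces by the norm in the cells. -/
noncomputable def _root_.DGFEM.facesTraceConst (n p : ℕ) (θ : ℝ) : ℝ :=
  2 * ((n + 2) * traceConst n p θ)

theorem diam_le_shapeRegularity_mul {K : Finset (E (n + 1))} (hK : K ∈ T.cells) :
    Metric.diam (hull K) ≤ T.shapeRegularity * inballDiam (hull K) := by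
  rw [← div_le_iff₀ (isCell hK).inballDiam_pos]
  exact le_ciSup (f := fun K : T.cells => Metric.diam (hull K.1) / inballDiam (hull K.1))
    (Set.finite_range _).bddAbove ⟨K, hK⟩

theorem shapeRegularity_nonneg : 0 ≤ T.shapeRegularity :=
  Real.iSup_nonneg fun K => div_nonneg Metric.diam_nonneg (isCell K.2).inballDiam_pos.le

theorem facesTraceConst_nonneg (p : ℕ) : 0 ≤ facesTraceConst n p T.shapeRegularity := by
  have := traceConst_nonneg n p (shapeRegularity_nonneg (T := T))
  unfold facesTraceConst
  positivity

theorem sum_traceSum_le {p : ℕ} (hn : n ≠ 0)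
    {q : Finset (E (n + 1)) → MvPolynomial (Fin (n + 1)) ℝ}
    (hq : ∀ K ∈ T.cells, (q K).totalDegree ≤ p) :
    ∑ F ∈ T.facets, faceSize F *
        ∫ x in hull F, T.traceSum q F x ^ 2 ∂(μHE[n] : Measure (E (n + 1)))
      ≤ facesTraceConst n p T.shapeRegularity * T.cellNormSq q := by
  classical
  set τ := traceConst n p T.shapeRegularity with hτ
  set I : Finset (E (n + 1)) → ℝ := fun K => ∫ x in hull K, polyVal (q K) x ^ 2 with hI
  have hI0 : ∀ K, 0 ≤ I K := fun K => integral_nonneg fun x => sq_nonneg _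
  have hτ0 : 0 ≤ τ := traceConst_nonneg n p shapeRegularity_nonneg
  have hF : ∀ F ∈ T.facets, faceSize F *
        ∫ x in hull F, T.traceSum q F x ^ 2 ∂(μHE[n] : Measure (E (n + 1)))
      ≤ ∑ K ∈ T.adjacentCells F, 2 * τ * I K := by
    intro F hF
    have hFc := ((T.mem_facets).1 hF).2
    have h1 : ∫ x in hull F, T.traceSum q F x ^ 2 ∂(μHE[n] : Measure (E (n + 1)))
        ≤ ∫ x in hull F, ∑ K ∈ T.adjacentCells F, 2 * polyVal (q K) x ^ 2
            ∂(μHE[n] : Measure (E (n + 1))) := by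
      refine integral_mono (integrableOn_face hFc ((continuous_traceSum q F).pow 2))
        (integrableOn_face hFc (continuous_finsetSum _ fun K _ =>
          continuous_const.mul ((polyVal_continuous _).pow 2))) fun x => ?_
      have h2 := sq_sum_le_card_mul_sum_sq (s := T.adjacentCells F)
        (f := fun K => |polyVal (q K) x|)
      simp only [sq_abs] at h2
      have h3 : ((T.adjacentCells F).card : ℝ) ≤ 2 := by
        exact_mod_cast card_adjacentCells_le hF
      simp only [traceSum, ← Finset.mul_sum]
      exact h2.trans (mul_le_mul_of_nonneg_right h3
        (Finset.sum_nonneg fun _ _ => sq_nonneg _))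
    have hint : ∀ K ∈ T.adjacentCells F, IntegrableOn (fun x => 2 * polyVal (q K) x ^ 2) (hull F)
        (μHE[n] : Measure (E (n + 1))) := fun K _ =>
      integrableOn_face hFc (continuous_const.mul ((polyVal_continuous _).pow 2))
    rw [integral_finsetSum _ hint] at h1
    refine (mul_le_mul_of_nonneg_left h1 (faceSize_nonneg F)).trans ?_
    rw [Finset.mul_sum]
    refine Finset.sum_le_sum fun K hK => ?_
    obtain ⟨hK, hFK⟩ := (T.mem_adjacentCells).1 hK
    rw [integral_const_mul]
    have h4 := (isCell hK).trace_inequality hn hFc hFK (diam_le_shapeRegularity_mul hK) (hq K hK)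
    linarith
  refine (Finset.sum_le_sum hF).trans ?_
  have hswap : ∑ F ∈ T.facets, ∑ K ∈ T.adjacentCells F, 2 * τ * I K
      = ∑ K ∈ T.cells, ∑ F ∈ T.facets with F ⊆ K, 2 * τ * I K := by
    refine Finset.sum_comm' fun F K => ?_
    rw [Finset.mem_filter, mem_adjacentCells]
    tauto
  rw [hswap, cellNormSq, Finset.mul_sum]
  refine Finset.sum_le_sum fun K hK => ?_
  have hcard : (T.facets.filter fun F => F ⊆ K).card ≤ n + 2 := by
    have hsub : (T.facets.filter fun F => F ⊆ K) ⊆ K.powersetCard (n + 1) := by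
      intro F hF
      rw [Finset.mem_filter, mem_facets] at hF
      exact Finset.mem_powersetCard.2 ⟨hF.2, hF.1.2⟩
    refine (Finset.card_le_card hsub).trans ?_
    rw [Finset.card_powersetCard, (isCell hK).card, Nat.choose_succ_self_right]
  have hcard' : ((T.facets.filter fun F => F ⊆ K).card : ℝ) ≤ n + 2 := by
    exact_mod_cast hcard
  rw [Finset.sum_const, nsmul_eq_mul, facesTraceConst, ← hτ]
  calc _ ≤ ((n : ℝ) + 2) * (2 * τ * I K) :=
        mul_le_mul_of_nonneg_right hcard' (mul_nonneg (by positivity) (hI0 K))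
    _ = 2 * ((n + 2) * τ) * I K := by ring

theorem inv_faceSize_mul_jumpNormSq_le (hn : n ≠ 0) (hΩ : Bornology.IsBounded Ω)
    (q : Finset (E (n + 1)) → MvPolynomial (Fin (n + 1)) ℝ) {F : Finset (E (n + 1))}
    (hF : F ∈ T.facets) :
    (faceSize F)⁻¹ * T.jumpNormSq q F
      ≤ (n * Metric.diam Ω) ^ 2 * ((faceSize F ^ 3)⁻¹ * T.jumpNormSq q F) := by
  have hpos := faceSize_pos hn hF
  by_cases h : ∃ K ∈ T.cells, F ⊆ K
  · obtain ⟨K, hK, hFK⟩ := h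
    have h1 := faceSize_le hn ((T.mem_facets).1 hF).2 hFK
    have h2 : Metric.diam (hull K) ≤ Metric.diam Ω := by
      rw [← Metric.diam_closure Ω]
      exact Metric.diam_mono (cells_subset_closure hK) hΩ.closure
    have h3 : faceSize F ≤ n * Metric.diam Ω :=
      h1.trans (mul_le_mul_of_nonneg_left h2 (Nat.cast_nonneg _))
    have h4 : (faceSize F)⁻¹ = faceSize F ^ 2 * (faceSize F ^ 3)⁻¹ := by field_simp
    rw [← mul_assoc]
    refine mul_le_mul_of_nonneg_right ?_ (jumpNormSq_nonneg q F)
    rw [h4]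
    exact mul_le_mul_of_nonneg_right (pow_le_pow_left₀ hpos.le h3 2) (by positivity)
  · have h0 : T.adjacentCells F = ∅ := by
      rw [Finset.eq_empty_iff_forall_notMem]
      intro K hK
      exact h ⟨K, (T.mem_adjacentCells).1 hK⟩
    have hb : ¬ ∃ K K', K ∈ T.cells ∧ K' ∈ T.cells ∧ K ≠ K' ∧ F ⊆ K ∧ F ⊆ K' := by
      rintro ⟨K, -, hK, -, -, hFK, -⟩
      exact h ⟨K, hK, hFK⟩
    have : T.jumpNormSq q F = 0 := by
      simp [jumpNormSq, polyJump, jump_of_boundary hb, h0]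
    simp [this]

end Mesh

/-! ### The Poincaré–Friedrichs inequality for piecewise polynomials -/

/-- Young's inequality with the weights of the jumps `a` and the traces `s`. -/
theorem abs_mul_le_young {a s h δ : ℝ} (hh : 0 < h) (hδ : 0 < δ) :
    |a| * s ≤ δ * h * s ^ 2 + (4 * δ)⁻¹ * h⁻¹ * a ^ 2 := by
  have h1 : δ * h * s ^ 2 + (4 * δ)⁻¹ * h⁻¹ * a ^ 2 - |a| * s
      = δ * h * (s - (2 * δ)⁻¹ * h⁻¹ * |a|) ^ 2 := by
    rw [← sq_abs a]
    field_simp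
    ring
  have h2 : 0 ≤ δ * h * (s - (2 * δ)⁻¹ * h⁻¹ * |a|) ^ 2 := by positivity
  linarith

/-- The absorption step of the Poincaré inequality: a quarter of `V` comes from the volume integral
and another one from the traces. -/
theorem le_of_absorb_quarter {V A B G G' J D N s δ : ℝ} (hV : V ≤ A + (4⁻¹ * V + 4 * D ^ 2 * G'))
    (hA : A ≤ B) (hB : B ≤ δ * (s * V) + D ^ 2 * (s + 1) * (N ^ 2 * J)) (hδ : δ * s ≤ 4⁻¹)
    (hs : 0 ≤ s) (hV0 : 0 ≤ V) (hG0 : 0 ≤ G) (hJ0 : 0 ≤ J) (hG : G' ≤ G) :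
    V ≤ (8 * D ^ 2 + 2 * D ^ 2 * (s + 1) * N ^ 2) * (G + J) := by
  have h1 := mul_le_mul_of_nonneg_right hδ hV0
  have h2 := mul_le_mul_of_nonneg_left hG (by positivity : 0 ≤ 4 * D ^ 2)
  have h3 : V ≤ 8 * D ^ 2 * G + 2 * D ^ 2 * (s + 1) * N ^ 2 * J := by linarith
  have h4 : 0 ≤ 8 * D ^ 2 * J := by positivity
  have h5 : 0 ≤ 2 * D ^ 2 * (s + 1) * N ^ 2 * G := by positivity
  linarith

/-- The absorption step of the gradient bound: `V` is first replaced by `G + J`. -/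
theorem le_of_absorb_half {V G H H' I J N R c m s ε : ℝ}
    (hG : G ≤ ε * s * G + ε * (s + 1) * ((R + 1) * V)
      + (m + 1) / 2 * (N ^ 2 * ((R + 1) * J) + I + H'))
    (hV : V ≤ c * (G + J)) (hε : ε * m ≤ 2⁻¹) (hm : m = (R + 1) * (s + 1) * c + s)
    (hε0 : 0 ≤ ε) (hs0 : 0 ≤ s) (hm0 : 0 ≤ m) (hR : 0 ≤ R) (hG0 : 0 ≤ G) (hJ0 : 0 ≤ J)
    (hI0 : 0 ≤ I) (hH0 : 0 ≤ H) (hH : H' ≤ H) :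
    G ≤ (1 + (m + 1) * (1 + (R + 1) * N ^ 2)) * (H + (I + J)) := by
  -- the terms with the factor `ε` add up to at most `ε m (G + J)`
  have h1 : ε * s * G + (R + 1) * (ε * (s + 1) * V) ≤ 2⁻¹ * (G + J) := by
    have h2 : (R + 1) * (ε * (s + 1) * V) ≤ (R + 1) * (ε * (s + 1) * (c * (G + J))) := by
      gcongr
    have h3 : ε * s * G ≤ ε * s * (G + J) := by gcongr; linarith
    have h4 := mul_le_mul_of_nonneg_right hε (add_nonneg hG0 hJ0)
    rw [hm] at h4
    linarith
  have h5 := mul_le_mul_of_nonneg_left hH (by positivity : 0 ≤ (m + 1) / 2)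
  have h6 : G ≤ J + (m + 1) * ((R + 1) * (N ^ 2 * J) + I + H) := by linarith
  have h7 : 0 ≤ (m + 1) * ((R + 1) * N ^ 2 * (H + I)) := by positivity
  have h8 : 0 ≤ (m + 1) * J := by positivity
  linarith

/-- The constant in the bound of the `L²` norm by the gradient and the jumps. -/
noncomputable def poincareConst (n p : ℕ) (θ D : ℝ) : ℝ :=
  8 * D ^ 2 + 2 * D ^ 2 * (facesTraceConst n p θ + 1) * (n * D) ^ 2

/-- Controls the size of the parameter in Young's inequality in the bound of the gradient. -/
noncomputable def absorptionConst (n p : ℕ) (θ D : ℝ) : ℝ :=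
  (n + 1) * (facesTraceConst n p θ + 1) * poincareConst n p θ D + facesTraceConst n p θ

/-- The constant in the bound of the gradient by the Hessian and the jumps. -/
noncomputable def gradientConst (n p : ℕ) (θ D : ℝ) : ℝ :=
  1 + (absorptionConst n p θ D + 1) * (1 + (n + 1) * (n * D) ^ 2)

namespace Mesh

variable {n : ℕ} {Ω : Set (E (n + 1))} {T : Mesh Ω}

theorem facet_subset_closure {F : Finset (E (n + 1))} (hF : F ∈ T.facets) :
    hull F ⊆ closure Ω := by
  rw [← T.space_eq]
  exact T.convexHull_subset_space ((T.mem_facets).1 hF).1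

/-- Young's inequality for the jump of `u² η` with a bounded continuous factor `η`. -/
theorem integral_abs_polyJump_sq_mul_le (hn : n ≠ 0)
    (u : Finset (E (n + 1)) → MvPolynomial (Fin (n + 1)) ℝ)
    {η : MvPolynomial (Fin (n + 1)) ℝ} {D : ℝ} (hη : ∀ x ∈ closure Ω, |polyVal η x| ≤ D)
    {F : Finset (E (n + 1))} (hF : F ∈ T.facets) {δ : ℝ} (hδ : 0 < δ) :
    ∫ x in hull F, |T.polyJump (fun K => u K * u K * η) F x| ∂(μHE[n] : Measure (E (n + 1)))
      ≤ δ * (faceSize F *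
          ∫ x in hull F, T.traceSum u F x ^ 2 ∂(μHE[n] : Measure (E (n + 1))))
        + D ^ 2 * (4 * δ)⁻¹ * ((faceSize F)⁻¹ * T.jumpNormSq u F) := by
  have hFc := ((T.mem_facets).1 hF).2
  have hh := faceSize_pos hn hF
  have hc1 : Continuous fun x => δ * faceSize F * T.traceSum u F x ^ 2 :=
    continuous_const.mul ((continuous_traceSum u F).pow 2)
  have hc2 : Continuous fun x => D ^ 2 * (4 * δ)⁻¹ * (faceSize F)⁻¹ * T.polyJump u F x ^ 2 :=
    continuous_const.mul ((continuous_polyJump u F).pow 2)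
  have h1 : ∫ x in hull F, |T.polyJump (fun K => u K * u K * η) F x|
        ∂(μHE[n] : Measure (E (n + 1)))
      ≤ ∫ x in hull F, (δ * faceSize F * T.traceSum u F x ^ 2
        + D ^ 2 * (4 * δ)⁻¹ * (faceSize F)⁻¹ * T.polyJump u F x ^ 2)
        ∂(μHE[n] : Measure (E (n + 1))) := by
    refine setIntegral_mono_on (integrableOn_face hFc (continuous_polyJump _ F).abs)
      (integrableOn_face hFc (hc1.add hc2)) (isCompact_hull F).measurableSet fun x hx => ?_
    refine (abs_polyJump_sq_mul_le u η hF x).trans ?_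
    have hD := hη x (facet_subset_closure hF hx)
    have hS : 0 ≤ T.traceSum u F x := Finset.sum_nonneg fun _ _ => abs_nonneg _
    have h2 := abs_mul_le_young (a := D * T.polyJump u F x) (s := T.traceSum u F x) hh hδ
    have hD0 : 0 ≤ D := (abs_nonneg _).trans hD
    rw [abs_mul, abs_of_nonneg hD0] at h2
    calc |polyVal η x| * (|T.polyJump u F x| * T.traceSum u F x)
        ≤ D * (|T.polyJump u F x| * T.traceSum u F x) :=
          mul_le_mul_of_nonneg_right hD (mul_nonneg (abs_nonneg _) hS)
      _ = D * |T.polyJump u F x| * T.traceSum u F x := by ring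
      _ ≤ _ := h2
      _ = _ := by ring
  rw [integral_add (integrableOn_face hFc hc1) (integrableOn_face hFc hc2), integral_const_mul,
    integral_const_mul] at h1
  refine h1.trans (le_of_eq ?_)
  rw [jumpNormSq]
  ring

open Classical in
/-- Young's inequality for the jump of a product; the jump of the second factor occurs only on
interior faces. -/
theorem integral_abs_polyJump_mul_le (hn : n ≠ 0)
    (u w : Finset (E (n + 1)) → MvPolynomial (Fin (n + 1)) ℝ)
    {F : Finset (E (n + 1))} (hF : F ∈ T.facets) {δ : ℝ} (hδ : 0 < δ) :
    ∫ x in hull F, |T.polyJump (fun K => u K * w K) F x| ∂(μHE[n] : Measure (E (n + 1)))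
      ≤ δ * (faceSize F *
          ∫ x in hull F, T.traceSum w F x ^ 2 ∂(μHE[n] : Measure (E (n + 1))))
        + (4 * δ)⁻¹ * ((faceSize F)⁻¹ * T.jumpNormSq u F)
        + (δ * (faceSize F *
            ∫ x in hull F, T.traceSum u F x ^ 2 ∂(μHE[n] : Measure (E (n + 1))))
          + (4 * δ)⁻¹ *
            (if F ∈ T.interiorFacets then (faceSize F)⁻¹ * T.jumpNormSq w F else 0)) := by
  have hFc := ((T.mem_facets).1 hF).2
  have hh := faceSize_pos hn hF
  set ι : ℝ := if F ∈ T.interiorFacets then 1 else 0 with hι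
  have hS : ∀ q x, 0 ≤ T.traceSum q F x := fun q x => Finset.sum_nonneg fun _ _ => abs_nonneg _
  have hc1 : Continuous fun x => δ * faceSize F * T.traceSum w F x ^ 2 :=
    continuous_const.mul ((continuous_traceSum w F).pow 2)
  have hc2 : Continuous fun x => (4 * δ)⁻¹ * (faceSize F)⁻¹ * T.polyJump u F x ^ 2 :=
    continuous_const.mul ((continuous_polyJump u F).pow 2)
  have hc3 : Continuous fun x => δ * faceSize F * T.traceSum u F x ^ 2 :=
    continuous_const.mul ((continuous_traceSum u F).pow 2)
  have hc4 : Continuous fun x => (4 * δ)⁻¹ * (ι * (faceSize F)⁻¹) * T.polyJump w F x ^ 2 :=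
    continuous_const.mul ((continuous_polyJump w F).pow 2)
  have hc12 : Continuous fun x => δ * faceSize F * T.traceSum w F x ^ 2
      + (4 * δ)⁻¹ * (faceSize F)⁻¹ * T.polyJump u F x ^ 2 := hc1.add hc2
  have hc34 : Continuous fun x => δ * faceSize F * T.traceSum u F x ^ 2
      + (4 * δ)⁻¹ * (ι * (faceSize F)⁻¹) * T.polyJump w F x ^ 2 := hc3.add hc4
  have h1 : ∫ x in hull F, |T.polyJump (fun K => u K * w K) F x| ∂(μHE[n] : Measure (E (n + 1)))
      ≤ ∫ x in hull F, ((δ * faceSize F * T.traceSum w F x ^ 2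
          + (4 * δ)⁻¹ * (faceSize F)⁻¹ * T.polyJump u F x ^ 2)
        + (δ * faceSize F * T.traceSum u F x ^ 2
          + (4 * δ)⁻¹ * (ι * (faceSize F)⁻¹) * T.polyJump w F x ^ 2))
        ∂(μHE[n] : Measure (E (n + 1))) := by
    refine integral_mono (integrableOn_face hFc (continuous_polyJump _ F).abs)
      (integrableOn_face hFc (hc12.add hc34)) fun x => ?_
    refine (abs_polyJump_mul_le u w hF x).trans (add_le_add ?_ ?_)
    · exact abs_mul_le_young hh hδ
    · by_cases h : F ∈ T.interiorFacets
      · rw [if_pos h]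
        simp only [hι, if_pos h, one_mul]
        rw [mul_comm]
        exact abs_mul_le_young hh hδ
      · rw [if_neg h]
        simp only [hι, if_neg h, zero_mul, mul_zero, add_zero]
        positivity
  rw [integral_add (integrableOn_face hFc hc12) (integrableOn_face hFc hc34),
    integral_add (integrableOn_face hFc hc1) (integrableOn_face hFc hc2),
    integral_add (integrableOn_face hFc hc3) (integrableOn_face hFc hc4),
    integral_const_mul, integral_const_mul, integral_const_mul, integral_const_mul] at h1
  have hif : (if F ∈ T.interiorFacets then (faceSize F)⁻¹ * T.jumpNormSq w F else 0)
      = ι * ((faceSize F)⁻¹ * T.jumpNormSq w F) := by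
    simp only [hι, ite_mul, one_mul, zero_mul]
  rw [hif]
  refine h1.trans (le_of_eq ?_)
  rw [jumpNormSq, jumpNormSq]
  ring

/-- The weighted squared jumps of a piecewise polynomial function across all faces. -/
noncomputable def allJumps (T : Mesh Ω)
    (q : Finset (E (n + 1)) → MvPolynomial (Fin (n + 1)) ℝ) : ℝ :=
  ∑ F ∈ T.facets, (faceSize F ^ 3)⁻¹ * T.jumpNormSq q F

/-- The weighted squared jumps of a piecewise polynomial function across the interior faces. -/
noncomputable def interiorJumps (T : Mesh Ω)
    (q : Finset (E (n + 1)) → MvPolynomial (Fin (n + 1)) ℝ) : ℝ :=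
  ∑ F ∈ T.interiorFacets, (faceSize F)⁻¹ * T.jumpNormSq q F

theorem allJumps_nonneg (q : Finset (E (n + 1)) → MvPolynomial (Fin (n + 1)) ℝ) :
    0 ≤ T.allJumps q :=
  Finset.sum_nonneg fun F _ => mul_nonneg (inv_nonneg.2 (pow_nonneg (faceSize_nonneg F) 3))
    (jumpNormSq_nonneg q F)

theorem interiorJumps_nonneg (q : Finset (E (n + 1)) → MvPolynomial (Fin (n + 1)) ℝ) :
    0 ≤ T.interiorJumps q :=
  Finset.sum_nonneg fun F _ => mul_nonneg (inv_nonneg.2 (faceSize_nonneg F))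
    (jumpNormSq_nonneg q F)

theorem sum_inv_faceSize_mul_jumpNormSq_le (hn : n ≠ 0) (hΩ : Bornology.IsBounded Ω)
    (q : Finset (E (n + 1)) → MvPolynomial (Fin (n + 1)) ℝ) :
    ∑ F ∈ T.facets, (faceSize F)⁻¹ * T.jumpNormSq q F
      ≤ (n * Metric.diam Ω) ^ 2 * T.allJumps q := by
  rw [allJumps, Finset.mul_sum]
  exact Finset.sum_le_sum fun F hF => inv_faceSize_mul_jumpNormSq_le hn hΩ q hF

theorem poincareConst_nonneg (p : ℕ) (D : ℝ) :
    0 ≤ poincareConst n p T.shapeRegularity D := by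
  have := facesTraceConst_nonneg (T := T) p
  unfold poincareConst
  positivity

theorem absorptionConst_nonneg (p : ℕ) (D : ℝ) :
    0 ≤ absorptionConst n p T.shapeRegularity D := by
  have := facesTraceConst_nonneg (T := T) p
  have := poincareConst_nonneg (T := T) p D
  unfold absorptionConst
  positivity

theorem gradientConst_nonneg (p : ℕ) (D : ℝ) :
    0 ≤ gradientConst n p T.shapeRegularity D := by
  have := absorptionConst_nonneg (T := T) p D
  unfold gradientConst
  positivity

/-- The Poincaré inequality: integrate the derivative of `q² (x₀ - c)` in the first coordinate. -/
theorem cellNormSq_le {p : ℕ} (hn : n ≠ 0) (hne : Ω.Nonempty) (hΩ : Bornology.IsBounded Ω)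
    {q : Finset (E (n + 1)) → MvPolynomial (Fin (n + 1)) ℝ}
    (hq : ∀ K ∈ T.cells, (q K).totalDegree ≤ p) :
    T.cellNormSq q ≤ poincareConst n p T.shapeRegularity (Metric.diam Ω)
      * (∑ i, T.cellNormSq (fun K => MvPolynomial.pderiv i (q K)) + T.allJumps q) := by
  obtain ⟨z, hz⟩ := hne
  set D := Metric.diam Ω with hD
  set s := facesTraceConst n p T.shapeRegularity with hs
  have hs0 : 0 ≤ s := facesTraceConst_nonneg p
  -- the factor `x₀ - z₀` is at most the diameter on the domain, since `z` lies in it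
  set η : MvPolynomial (Fin (n + 1)) ℝ := MvPolynomial.X 0 - MvPolynomial.C (z 0) with hη
  have hηx : ∀ x, polyVal η x = x 0 - z 0 := fun x => by simp [polyVal, hη]
  have hηD : ∀ x ∈ closure Ω, |polyVal η x| ≤ D := by
    intro x hx
    rw [hηx]
    calc |x 0 - z 0| = ‖(x - z) 0‖ := by simp [Real.norm_eq_abs]
      _ ≤ ‖x - z‖ := PiLp.norm_apply_le _ _
      _ = dist x z := (dist_eq_norm _ _).symm
      _ ≤ D := by
        rw [hD, ← Metric.diam_closure Ω]
        exact Metric.dist_le_diam_of_mem hΩ.closure hx (subset_closure hz)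
  set g : Finset (E (n + 1)) → MvPolynomial (Fin (n + 1)) ℝ := fun K => q K * q K * η with hg
  set q' : Finset (E (n + 1)) → MvPolynomial (Fin (n + 1)) ℝ :=
    fun K => MvPolynomial.pderiv 0 (q K) with hq'
  have hderiv : ∀ K x, polyVal (MvPolynomial.pderiv 0 (g K)) x
      = polyVal (q K) x ^ 2 + 2 * polyVal (q K) x * polyVal (q' K) x * polyVal η x := by
    intro K x
    simp only [hg, hη, hq', Derivation.leibniz, smul_eq_mul, map_sub, MvPolynomial.pderiv_X_self,
      MvPolynomial.pderiv_C, polyVal_add, polyVal_mul, sub_zero]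
    have h1 : polyVal (1 : MvPolynomial (Fin (n + 1)) ℝ) x = 1 := by simp [polyVal]
    rw [h1]
    ring
  have hcell : ∀ K ∈ T.cells, ∫ x in hull K, polyVal (q K) x ^ 2
      ≤ (∫ x in hull K, polyVal (MvPolynomial.pderiv 0 (g K)) x)
        + (4⁻¹ * (∫ x in hull K, polyVal (q K) x ^ 2)
          + 4 * D ^ 2 * ∫ x in hull K, polyVal (q' K) x ^ 2) := by
    intro K hK
    have hc1 : Continuous fun x => 4⁻¹ * polyVal (q K) x ^ 2 :=
      continuous_const.mul ((polyVal_continuous _).pow 2)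
    have hc2 : Continuous fun x => 4 * D ^ 2 * polyVal (q' K) x ^ 2 :=
      continuous_const.mul ((polyVal_continuous _).pow 2)
    have hc12 : Continuous fun x => 4⁻¹ * polyVal (q K) x ^ 2 + 4 * D ^ 2 * polyVal (q' K) x ^ 2 :=
      hc1.add hc2
    have hc3 := polyVal_continuous (MvPolynomial.pderiv 0 (g K))
    rw [← integral_const_mul, ← integral_const_mul,
      ← integral_add (integrableOn_hull K hc1) (integrableOn_hull K hc2),
      ← integral_add (integrableOn_hull K hc3) (integrableOn_hull K hc12)]
    refine setIntegral_mono_on (integrableOn_hull K ((polyVal_continuous _).pow 2))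
      (integrableOn_hull K (hc3.add hc12)) (isCompact_hull K).measurableSet
      fun x hx => ?_
    rw [hderiv]
    have h1 := hηD x (cells_subset_closure hK hx)
    have h2 : polyVal η x ^ 2 ≤ D ^ 2 := by
      rw [← sq_abs]
      exact pow_le_pow_left₀ (abs_nonneg _) h1 2
    have h3 := mul_le_mul_of_nonneg_right h2 (sq_nonneg (polyVal (q' K) x))
    nlinarith [sq_nonneg (2⁻¹ * polyVal (q K) x + 2 * (polyVal (q' K) x * polyVal η x))]
  have hsum := Finset.sum_le_sum hcell
  rw [Finset.sum_add_distrib, Finset.sum_add_distrib, ← Finset.mul_sum, ← Finset.mul_sum] at hsum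
  have hdiv := (le_abs_self _).trans (abs_sum_integral_pderiv_le (T := T) g 0)
  -- the traces then contribute at most a quarter of the left-hand side
  set δ : ℝ := (4 * (s + 1))⁻¹ with hδ
  have hδ0 : 0 < δ := by positivity
  have hδ4 : (4 * δ)⁻¹ = s + 1 := by rw [hδ]; field_simp
  have hδs : δ * s ≤ 4⁻¹ := by
    rw [hδ, inv_mul_le_iff₀ (by positivity)]
    linarith
  have hfaces : ∑ F ∈ T.facets, ∫ x in hull F, |T.jump (fun K => polyVal (g K) x) F|
        ∂(μHE[n] : Measure (E (n + 1)))
      ≤ δ * (s * T.cellNormSq q) + D ^ 2 * (s + 1) * ((n * D) ^ 2 * T.allJumps q) := by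
    refine (Finset.sum_le_sum fun F hF =>
      integral_abs_polyJump_sq_mul_le hn q hηD hF hδ0).trans ?_
    rw [Finset.sum_add_distrib, ← Finset.mul_sum, ← Finset.mul_sum, hδ4]
    refine add_le_add (mul_le_mul_of_nonneg_left (sum_traceSum_le hn hq) hδ0.le)
      (mul_le_mul_of_nonneg_left (sum_inv_faceSize_mul_jumpNormSq_le hn hΩ q) (by positivity))
  have hG : T.cellNormSq q' ≤ ∑ i, T.cellNormSq (fun K => MvPolynomial.pderiv i (q K)) :=
    Finset.single_le_sum (f := fun i => T.cellNormSq (fun K => MvPolynomial.pderiv i (q K)))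
      (fun i _ => cellNormSq_nonneg _) (Finset.mem_univ 0)
  set G := ∑ i, T.cellNormSq (fun K => MvPolynomial.pderiv i (q K))
  have hG0 : 0 ≤ G := Finset.sum_nonneg fun i _ => cellNormSq_nonneg _
  have hV0 := cellNormSq_nonneg (T := T) q
  have hJ0 := allJumps_nonneg (T := T) q
  change T.cellNormSq q ≤ _ + (4⁻¹ * T.cellNormSq q + 4 * D ^ 2 * T.cellNormSq q') at hsum
  rw [poincareConst, ← hs]
  exact le_of_absorb_quarter hsum hdiv hfaces hδs hs0 hV0 hG0 hJ0 hG

/-- The bound of the gradient: integrate the derivatives of `q ∂ᵢq`, and absorb the terms without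
second derivatives and jumps. -/
theorem sum_cellNormSq_pderiv_le {p : ℕ} (hn : n ≠ 0) (hne : Ω.Nonempty)
    (hΩ : Bornology.IsBounded Ω)
    {q : Finset (E (n + 1)) → MvPolynomial (Fin (n + 1)) ℝ}
    (hq : ∀ K ∈ T.cells, (q K).totalDegree ≤ p) :
    ∑ i, T.cellNormSq (fun K => MvPolynomial.pderiv i (q K))
      ≤ gradientConst n p T.shapeRegularity (Metric.diam Ω)
        * (∑ i, ∑ j, T.cellNormSq
            (fun K => MvPolynomial.pderiv j (MvPolynomial.pderiv i (q K)))
          + (∑ i, T.interiorJumps (fun K => MvPolynomial.pderiv i (q K)) + T.allJumps q)) := by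
  classical
  set D := Metric.diam Ω with hD
  set s := facesTraceConst n p T.shapeRegularity with hs
  have hs0 : 0 ≤ s := facesTraceConst_nonneg p
  have hPF := cellNormSq_le (T := T) hn hne hΩ hq
  set c := poincareConst n p T.shapeRegularity D with hc
  have hc0 : 0 ≤ c := poincareConst_nonneg p D
  set m := absorptionConst n p T.shapeRegularity D with hm
  have hm0 : 0 ≤ m := absorptionConst_nonneg p D
  have hm' : m = (n + 1) * (s + 1) * c + s := rfl
  set V := T.cellNormSq q with hV
  have hV0 : 0 ≤ V := cellNormSq_nonneg q
  set J := T.allJumps q with hJ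
  have hJ0 : 0 ≤ J := allJumps_nonneg q
  set q' : Fin (n + 1) → Finset (E (n + 1)) → MvPolynomial (Fin (n + 1)) ℝ :=
    fun i K => MvPolynomial.pderiv i (q K) with hq'
  set q'' : Fin (n + 1) → Finset (E (n + 1)) → MvPolynomial (Fin (n + 1)) ℝ :=
    fun i K => MvPolynomial.pderiv i (MvPolynomial.pderiv i (q K)) with hq''
  have hq'd : ∀ i, ∀ K ∈ T.cells, (q' i K).totalDegree ≤ p := fun i K hK =>
    (totalDegree_pderiv_le i _).trans (hq K hK)
  -- `ε m ≤ 1 / 2` allows the absorption of half of the gradient term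
  set ε : ℝ := (2 * (m + 1))⁻¹ with hε
  have hε0 : 0 < ε := by positivity
  have hε4 : (4 * ε)⁻¹ = (m + 1) / 2 := by rw [hε]; field_simp; norm_num
  have hεm : ε * m ≤ 2⁻¹ := by
    rw [hε, inv_mul_le_iff₀ (by positivity)]
    linarith
  have hi : ∀ i, T.cellNormSq (q' i)
      ≤ ε * s * T.cellNormSq (q' i) + ε * (s + 1) * V
        + (m + 1) / 2 * ((n * D) ^ 2 * J + T.interiorJumps (q' i) + T.cellNormSq (q'' i)) := by
    intro i
    set g : Finset (E (n + 1)) → MvPolynomial (Fin (n + 1)) ℝ := fun K => q K * q' i K with hg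
    have hderiv : ∀ K x, polyVal (MvPolynomial.pderiv i (g K)) x
        = polyVal (q' i K) x ^ 2 + polyVal (q K) x * polyVal (q'' i K) x := by
      intro K x
      simp only [hg, hq', hq'', Derivation.leibniz, smul_eq_mul, polyVal_add, polyVal_mul]
      ring
    have hcell : ∀ K ∈ T.cells, ∫ x in hull K, polyVal (q' i K) x ^ 2
        ≤ (∫ x in hull K, polyVal (MvPolynomial.pderiv i (g K)) x)
          + (ε * (∫ x in hull K, polyVal (q K) x ^ 2)
            + (m + 1) / 2 * ∫ x in hull K, polyVal (q'' i K) x ^ 2) := by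
      intro K _
      have hc1 : Continuous fun x => ε * polyVal (q K) x ^ 2 :=
        continuous_const.mul ((polyVal_continuous _).pow 2)
      have hc2 : Continuous fun x => (m + 1) / 2 * polyVal (q'' i K) x ^ 2 :=
        continuous_const.mul ((polyVal_continuous _).pow 2)
      have hc12 : Continuous fun x => ε * polyVal (q K) x ^ 2
          + (m + 1) / 2 * polyVal (q'' i K) x ^ 2 := hc1.add hc2
      have hc3 := polyVal_continuous (MvPolynomial.pderiv i (g K))
      rw [← integral_const_mul, ← integral_const_mul,
        ← integral_add (integrableOn_hull K hc1) (integrableOn_hull K hc2),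
        ← integral_add (integrableOn_hull K hc3) (integrableOn_hull K hc12)]
      refine integral_mono (integrableOn_hull K ((polyVal_continuous _).pow 2))
        (integrableOn_hull K (hc3.add hc12)) fun x => ?_
      simp only [hderiv]
      have h1 := abs_mul_le_young (a := polyVal (q'' i K) x) (s := |polyVal (q K) x|)
        one_pos hε0
      rw [hε4, sq_abs, ← abs_mul, inv_one, mul_one, mul_one, mul_comm] at h1
      have h2 := neg_abs_le (polyVal (q K) x * polyVal (q'' i K) x)
      linarith
    have hsum := Finset.sum_le_sum hcell
    rw [Finset.sum_add_distrib, Finset.sum_add_distrib, ← Finset.mul_sum, ← Finset.mul_sum]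
      at hsum
    change T.cellNormSq (q' i) ≤ _ + (ε * V + (m + 1) / 2 * T.cellNormSq (q'' i)) at hsum
    have hdiv := (le_abs_self _).trans (abs_sum_integral_pderiv_le (T := T) g i)
    have hfaces : ∑ F ∈ T.facets, ∫ x in hull F, |T.jump (fun K => polyVal (g K) x) F|
          ∂(μHE[n] : Measure (E (n + 1)))
        ≤ ε * (s * T.cellNormSq (q' i)) + (m + 1) / 2 * ((n * D) ^ 2 * J)
          + (ε * (s * V) + (m + 1) / 2 * T.interiorJumps (q' i)) := by
      refine (Finset.sum_le_sum fun F hF =>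
        integral_abs_polyJump_mul_le hn q (q' i) hF hε0).trans ?_
      rw [Finset.sum_add_distrib, Finset.sum_add_distrib, Finset.sum_add_distrib,
        ← Finset.mul_sum, ← Finset.mul_sum, ← Finset.mul_sum, ← Finset.mul_sum, hε4]
      refine add_le_add (add_le_add ?_ ?_) (add_le_add ?_ ?_)
      · exact mul_le_mul_of_nonneg_left (sum_traceSum_le hn (hq'd i)) hε0.le
      · exact mul_le_mul_of_nonneg_left (sum_inv_faceSize_mul_jumpNormSq_le hn hΩ q)
          (by positivity)
      · exact mul_le_mul_of_nonneg_left (sum_traceSum_le hn hq) hε0.le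
      · refine mul_le_mul_of_nonneg_left (le_of_eq ?_) (by positivity)
        rw [← Finset.sum_filter, interiorJumps]
        refine Finset.sum_congr ?_ fun _ _ => rfl
        ext F
        rw [Finset.mem_filter]
        refine ⟨fun h => h.2, fun h => ⟨?_, h⟩⟩
        rw [interiorFacets] at h
        exact Finset.mem_of_mem_filter F h
    linarith
  have hsum := Finset.sum_le_sum fun i (_ : i ∈ Finset.univ) => hi i
  simp only [Finset.sum_add_distrib, ← Finset.mul_sum, Finset.sum_const, Finset.card_univ,
    Fintype.card_fin, nsmul_eq_mul] at hsum
  set G := ∑ i, T.cellNormSq (q' i) with hG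
  have hG0 : 0 ≤ G := Finset.sum_nonneg fun i _ => cellNormSq_nonneg _
  set I := ∑ i, T.interiorJumps (q' i) with hI
  have hI0 : 0 ≤ I := Finset.sum_nonneg fun i _ => interiorJumps_nonneg _
  have hH : ∑ i, T.cellNormSq (q'' i) ≤ ∑ i, ∑ j, T.cellNormSq
      (fun K => MvPolynomial.pderiv j (MvPolynomial.pderiv i (q K))) :=
    Finset.sum_le_sum fun i _ => Finset.single_le_sum (f := fun j => T.cellNormSq
      (fun K => MvPolynomial.pderiv j (MvPolynomial.pderiv i (q K))))
      (fun j _ => cellNormSq_nonneg _) (Finset.mem_univ i)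
  set H := ∑ i, ∑ j, T.cellNormSq
      (fun K => MvPolynomial.pderiv j (MvPolynomial.pderiv i (q K))) with hHdef
  have hH0 : 0 ≤ H := Finset.sum_nonneg fun i _ =>
    Finset.sum_nonneg fun j _ => cellNormSq_nonneg _
  push_cast at hsum
  change V ≤ c * (G + J) at hPF
  rw [gradientConst, ← hm]
  exact le_of_absorb_half hsum hPF hεm hm' hε0.le hs0 hm0 (Nat.cast_nonneg n) hG0 hJ0 hI0 hH0 hH

end Mesh

/-! ### The norms in terms of the local polynomials -/

namespace Mesh

variable {n : ℕ} {Ω : Set (E (n + 1))} {T : Mesh Ω}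

/-- The polynomials that represent `v` on the elements. -/
noncomputable def cellPoly (v : E (n + 1) → ℝ) (K : Finset (E (n + 1))) :
    MvPolynomial (Fin (n + 1)) ℝ :=
  localPoly v (hull K)

theorem cellPoly_spec {p : ℕ} {v : E (n + 1) → ℝ} (hv : v ∈ T.dgSpace p)
    {K : Finset (E (n + 1))} (hK : K ∈ T.cells) :
    (cellPoly v K).totalDegree ≤ p ∧ v =ᵐ[volume.restrict (hull K)] polyVal (cellPoly v K) := by
  obtain ⟨P, hP, h⟩ := hv.2 K hK
  rw [cellPoly, localPoly_eq (isCell hK).interior_nonempty h]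
  exact ⟨hP, h⟩

theorem jump_apply (w : Finset (E (n + 1)) → E (n + 1)) (F : Finset (E (n + 1)))
    (i : Fin (n + 1)) : T.jump w F i = T.jump (fun K => w K i) F := by
  by_cases h : ∃ K K', K ∈ T.cells ∧ K' ∈ T.cells ∧ K ≠ K' ∧ F ⊆ K ∧ F ⊆ K'
  · rw [jump, jump, dif_pos h, dif_pos h, PiLp.sub_apply]
  · rw [jump, jump, dif_neg h, dif_neg h]
    simp

theorem norm_jumpGrad_sq (v : E (n + 1) → ℝ) (F : Finset (E (n + 1))) (x : E (n + 1)) :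
    ‖T.jumpGrad v F x‖ ^ 2
      = ∑ i, T.polyJump (fun K => MvPolynomial.pderiv i (cellPoly v K)) F x ^ 2 := by
  rw [EuclideanSpace.real_norm_sq_eq]
  exact Finset.sum_congr rfl fun i _ => by rw [jumpGrad, jump_apply]; rfl

theorem jumpSeminormSq_eq (v : E (n + 1) → ℝ) :
    T.jumpSeminormSq v
      = ∑ i, T.interiorJumps (fun K => MvPolynomial.pderiv i (cellPoly v K))
        + T.allJumps (cellPoly v) := by
  classical
  rw [jumpSeminormSq]
  congr 1
  · simp only [interiorJumps]
    rw [Finset.sum_comm]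
    refine Finset.sum_congr rfl fun F hF => ?_
    have hFc : F.card = n + 1 :=
      ((T.mem_facets).1 (by rw [interiorFacets] at hF; exact Finset.mem_of_mem_filter F hF)).2
    simp only [norm_jumpGrad_sq]
    rw [integral_const_mul, ← Finset.mul_sum]
    congr 1
    exact integral_finsetSum _ fun i _ =>
      integrableOn_face hFc ((continuous_polyJump _ F).pow 2)
  · refine Finset.sum_congr rfl fun F _ => ?_
    rw [integral_const_mul]
    simp only [sq_abs]
    rfl

theorem sum_cells_sum_pderiv (T : Mesh Ω) {ι : Type*} [Fintype ι]
    (q : ι → Finset (E (n + 1)) → MvPolynomial (Fin (n + 1)) ℝ) :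
    ∑ K ∈ T.cells, ∫ x in hull K, ∑ i, polyVal (q i K) x ^ 2 = ∑ i, T.cellNormSq (q i) := by
  simp only [cellNormSq]
  rw [Finset.sum_comm]
  refine Finset.sum_congr rfl fun K _ => ?_
  exact integral_finsetSum _ fun i _ => integrableOn_hull K ((polyVal_continuous _).pow 2)

theorem hessSq_ae_eq (v : E (n + 1) → ℝ) {K : Finset (E (n + 1))} (hK : K ∈ T.cells) :
    T.hessSq v =ᵐ[volume.restrict (hull K)] fun x => ∑ ij : Fin (n + 1) × Fin (n + 1),
      polyVal (MvPolynomial.pderiv ij.2 (MvPolynomial.pderiv ij.1 (cellPoly v K))) x ^ 2 := by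
  filter_upwards [piecewise_ae_eq (T := T) (localHess v) hK] with x hx
  rw [Fintype.sum_prod_type]
  simp only [hessSq, hess, hx]
  rfl

theorem norm_grad_sq_ae_eq (v : E (n + 1) → ℝ) {K : Finset (E (n + 1))} (hK : K ∈ T.cells) :
    (fun x => ‖T.grad v x‖ ^ 2) =ᵐ[volume.restrict (hull K)]
      fun x => ∑ i, polyVal (MvPolynomial.pderiv i (cellPoly v K)) x ^ 2 := by
  filter_upwards [piecewise_ae_eq (T := T) (localGrad v) hK] with x hx
  simp only [grad, hx, EuclideanSpace.real_norm_sq_eq]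
  rfl

theorem continuous_sum_sq {ι : Type*} [Fintype ι] (q : ι → MvPolynomial (Fin (n + 1)) ℝ) :
    Continuous fun x => ∑ i, polyVal (q i) x ^ 2 :=
  continuous_finsetSum _ fun i _ => (polyVal_continuous (q i)).pow 2

theorem integral_hessSq (hΩ : Convex ℝ Ω) (v : E (n + 1) → ℝ) :
    ∫ x in Ω, T.hessSq v x = ∑ i, ∑ j, T.cellNormSq
      (fun K => MvPolynomial.pderiv j (MvPolynomial.pderiv i (cellPoly v K))) := by
  rw [setIntegral_eq_sum hΩ (fun K => continuous_sum_sq fun ij : Fin (n + 1) × Fin (n + 1) =>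
    MvPolynomial.pderiv ij.2 (MvPolynomial.pderiv ij.1 (cellPoly v K)))
    fun K hK => hessSq_ae_eq v hK, sum_cells_sum_pderiv T fun (ij : Fin (n + 1) × Fin (n + 1)) K =>
      MvPolynomial.pderiv ij.2 (MvPolynomial.pderiv ij.1 (cellPoly v K)), Fintype.sum_prod_type]

theorem integral_hessSq_add (hΩ : Convex ℝ Ω) {p : ℕ} {v : E (n + 1) → ℝ}
    (hv : v ∈ T.dgSpace p) :
    ∫ x in Ω, (T.hessSq v x + ‖T.grad v x‖ ^ 2 + |v x| ^ 2)
      = ∑ i, ∑ j, T.cellNormSq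
          (fun K => MvPolynomial.pderiv j (MvPolynomial.pderiv i (cellPoly v K)))
        + ∑ i, T.cellNormSq (fun K => MvPolynomial.pderiv i (cellPoly v K))
        + T.cellNormSq (cellPoly v) := by
  have hc1 := fun K => continuous_sum_sq fun ij : Fin (n + 1) × Fin (n + 1) =>
    MvPolynomial.pderiv ij.2 (MvPolynomial.pderiv ij.1 (cellPoly v K))
  have hc2 := fun K => continuous_sum_sq fun i => MvPolynomial.pderiv i (cellPoly v K)
  have hc3 := fun K => (polyVal_continuous (cellPoly v K)).pow 2
  rw [setIntegral_eq_sum hΩ (fun K => ((hc1 K).add (hc2 K)).add (hc3 K))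
    fun K hK => ?_]
  · rw [← Fintype.sum_prod_type', ← sum_cells_sum_pderiv T
        fun (ij : Fin (n + 1) × Fin (n + 1)) K =>
          MvPolynomial.pderiv ij.2 (MvPolynomial.pderiv ij.1 (cellPoly v K)),
      ← sum_cells_sum_pderiv T fun i K => MvPolynomial.pderiv i (cellPoly v K),
      cellNormSq, ← Finset.sum_add_distrib, ← Finset.sum_add_distrib]
    refine Finset.sum_congr rfl fun K _ => ?_
    rw [← integral_add (integrableOn_hull K (hc1 K)) (integrableOn_hull K (hc2 K))]
    exact integral_add (integrableOn_hull K ((hc1 K).add (hc2 K))) (integrableOn_hull K (hc3 K))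
  · filter_upwards [hessSq_ae_eq v hK, norm_grad_sq_ae_eq v hK, (cellPoly_spec hv hK).2]
      with x h1 h2 h3
    rw [h1, h2, h3, sq_abs]
    rfl

theorem meshNorm_le {p : ℕ} (hn : n ≠ 0) (hΩ : IsConvexPolytopalDomain Ω) {v : E (n + 1) → ℝ}
    (hv : v ∈ T.dgSpace p) :
    T.meshNorm v ≤ Real.sqrt (1 + gradientConst n p T.shapeRegularity (Metric.diam Ω)
        + poincareConst n p T.shapeRegularity (Metric.diam Ω)
          * (gradientConst n p T.shapeRegularity (Metric.diam Ω) + 1))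
      * Real.sqrt ((∫ x in Ω, T.hessSq v x) + T.jumpSeminormSq v) := by
  have hq : ∀ K ∈ T.cells, (cellPoly v K).totalDegree ≤ p := fun K hK => (cellPoly_spec hv hK).1
  have hG := sum_cellNormSq_pderiv_le (T := T) hn hΩ.nonempty hΩ.isBounded hq
  have hV := cellNormSq_le (T := T) hn hΩ.nonempty hΩ.isBounded hq
  have hc1 := poincareConst_nonneg (T := T) p (Metric.diam Ω)
  have hc2 := gradientConst_nonneg (T := T) p (Metric.diam Ω)
  have hH0 : 0 ≤ ∑ i, ∑ j, T.cellNormSq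
      (fun K => MvPolynomial.pderiv j (MvPolynomial.pderiv i (cellPoly v K))) :=
    Finset.sum_nonneg fun i _ => Finset.sum_nonneg fun j _ => cellNormSq_nonneg _
  have hI0 : 0 ≤ ∑ i, T.interiorJumps (fun K => MvPolynomial.pderiv i (cellPoly v K)) :=
    Finset.sum_nonneg fun i _ => interiorJumps_nonneg _
  have hJ0 := allJumps_nonneg (T := T) (cellPoly v)
  rw [meshNorm, integral_hessSq_add hΩ.convex hv, integral_hessSq hΩ.convex, jumpSeminormSq_eq,
    ← Real.sqrt_mul (by positivity)]
  refine Real.sqrt_le_sqrt ?_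
  generalize poincareConst n p T.shapeRegularity (Metric.diam Ω) = c at *
  generalize gradientConst n p T.shapeRegularity (Metric.diam Ω) = k at *
  generalize ∑ i, ∑ j, T.cellNormSq
    (fun K => MvPolynomial.pderiv j (MvPolynomial.pderiv i (cellPoly v K))) = H at *
  generalize ∑ i, T.interiorJumps (fun K => MvPolynomial.pderiv i (cellPoly v K)) = I at *
  generalize ∑ i, T.cellNormSq (fun K => MvPolynomial.pderiv i (cellPoly v K)) = G at *
  generalize T.allJumps (cellPoly v) = J at *
  generalize T.cellNormSq (cellPoly v) = V at *
  have h1 := mul_le_mul_of_nonneg_left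
    (add_le_add hG (by linarith : J ≤ H + (I + J))) hc1
  linarith

end Mesh

end DGFEM

theorem theorem3p1 :
    ∃ C : ℕ → ℝ → ℕ → ℝ → ℝ,
      ∀ d : ℕ, d = 2 ∨ d = 3 →
      ∀ p : ℕ, 2 ≤ p →
      ∀ Ω : Set (DGFEM.E d), DGFEM.IsConvexPolytopalDomain Ω →
      ∀ T : DGFEM.Mesh Ω, ∀ s : Fin 2, ∀ v ∈ T.feSpace p s,
        T.meshNorm v ≤ C d T.shapeRegularity p (Metric.diam Ω) *
          Real.sqrt ((∫ x in Ω, T.hessSq v x) + T.jumpSeminormSq v) := by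
  -- `feSpace` is contained in `dgSpace` for both `s`, and the constant does not depend on `s`
  refine ⟨fun d θ p D => Real.sqrt (1 + DGFEM.gradientConst (d - 1) p θ D
    + DGFEM.poincareConst (d - 1) p θ D * (DGFEM.gradientConst (d - 1) p θ D + 1)),
    fun d hd p _ Ω hΩ T s v hv => ?_⟩
  have hv0 : v ∈ T.dgSpace p := by
    unfold DGFEM.Mesh.feSpace at hv
    split_ifs at hv
    · exact hv
    · exact hv.1
  obtain ⟨n, rfl, hn⟩ : ∃ n, d = n + 1 ∧ n ≠ 0 := ⟨d - 1, by omega, by omega⟩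
  exact DGFEM.Mesh.meshNorm_le hn hΩ hv0
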